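/- For integers $k,n,m\ge 0$ let the conditional restricted Boltzmann machine $\mathrm{RBM}^k_{n,m}$ be the set of all conditional distributions (row-stochastic matrices $p(y|x)$, $x\in\{0,1\}^k$, $y\in\{0,1\}^n$) of the form $$p(y|x)=\frac{1}{Z(x)}\sum_{z\in\{0,1\}^m}\exp\bigl(z^\top Vx+z^\top Wy+b^\top y+c^\top z\bigr),\qquad Z(x)=\sum_{y\in\{0,1\}^n}\sum_{z\in\{0,1\}^m}\exp\bigl(z^\top Vx+z^\top Wy+b^\top y+c^\top z\bigr),$$ with $V\in\mathbb R^{m\times k}$, $W\in\mathbb R^{m\times n}$, $b\in\mathbb R^n$, $c\in\mathbb R^m$. Say that $\dim(\mathrm{RBM}^k_{n,m})=d$ if this set has Hausdorff dimension $d$ in $\mathbb R^{2^k\times 2^n}$ and the maximum over $(W,V,b,c)$ of the rank of the Jacobian of the parametrization $(W,V,b,c)\mapsto p$ is also $d$. The model has the expected dimension in the following cases. 1. Let $m\le 2^{(k+n)-\lfloor\log_2((k+n)^2-(k+n)+2)\rfloor}$. If $n\ge 1$ and $(k,n,m)$ is none of the triples $(0,1,1)$, $(1,1,1)$, $(0,2,1)$,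 $(2,1,1)$, $(3,1,2)$, then $$\dim(\mathrm{RBM}^k_{n,m})=(n+k+1)m+n,$$ the number of parameters. Moreover, without these restrictions on $(k,n,m)$, $\dim(\mathrm{RBM}^k_{n,m})=\min\{(n+k+1)m+n,\;2^k(2^n-1)\}$. 2. If $m\ge 2^{(k+n)-\lfloor\log_2(k+n+1)\rfloor}$, then $\dim(\mathrm{RBM}^k_{n,m})=2^k(2^n-1)$, the dimension of the polytope of all conditional distributions. -/

import Mathlib

namespace CRBM

/-- Binary state vectors, the elements of `{0,1}^n`. -/
abbrev State (n : ℕ) : Type := Fin n → Fin 2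

/-- A binary unit state, viewed as the real number `0` or `1`. -/
def bit (a : Fin 2) : ℝ := (a.val : ℝ)

/-- The space `ℝ^(2^k × 2^n)` of real matrices with rows indexed by inputs `x ∈ {0,1}^k` and
columns indexed by outputs `y ∈ {0,1}^n`. -/
abbrev Table (k n : ℕ) : Type := State k → State n → ℝ

/-- The parameters `θ = (W, V, b, c)`: interaction weights `W ∈ ℝ^(m × n)` (hidden-output) and
`V ∈ ℝ^(m × k)` (hidden-input), and biases `b ∈ ℝ^n` (output), `c ∈ ℝ^m` (hidden). -/
abbrev Param (k n m : ℕ) : Type :=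
  (Fin m → Fin n → ℝ) × (Fin m → Fin k → ℝ) × (Fin n → ℝ) × (Fin m → ℝ)

/-- The exponent `zᵀ V x + zᵀ W y + bᵀ y + cᵀ z`. -/
noncomputable def energy {k n m : ℕ} (θ : Param k n m) (x : State k) (y : State n)
    (z : State m) : ℝ :=
  (∑ i, ∑ j, bit (z i) * θ.2.1 i j * bit (x j))
    + (∑ i, ∑ j, bit (z i) * θ.1 i j * bit (y j))
    + (∑ j, θ.2.2.1 j * bit (y j))
    + ∑ i, θ.2.2.2 i * bit (z i)

/-- The normalization function: the sum over all output and hidden states, given the input. -/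
noncomputable def partitionFn {k n m : ℕ} (θ : Param k n m) (x : State k) : ℝ :=
  ∑ y : State n, ∑ z : State m, Real.exp (energy θ x y z)

/-- The parametrization of the model: `condProb θ x y = p(y | x)`. -/
noncomputable def condProb {k n m : ℕ} (θ : Param k n m) : Table k n :=
  fun x y => (1 / partitionFn θ x) * ∑ z : State m, Real.exp (energy θ x y z)

/-- The polytope of conditional distributions: the row-stochastic `2^k × 2^n` matrices. -/
def condDistributions (k n : ℕ) : Set (Table k n) :=
  {p | ∀ x, (∀ y, 0 ≤ p x y) ∧ ∑ y, p x y = 1}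

/-- The conditional restricted Boltzmann machine with `k` input, `n` output and `m` hidden units:
the set of conditional distributions that the parametrization represents. -/
def model (k n m : ℕ) : Set (Table k n) :=
  {p | p ∈ condDistributions k n ∧ ∃ θ : Param k n m, p = condProb θ}

/-- The rank of the Jacobian of the parametrization at `θ`. -/
noncomputable def jacobianRank {k n m : ℕ} (θ : Param k n m) : ℕ :=
  Module.finrank ℝ (LinearMap.range
    (fderiv ℝ (condProb : Param k n m → Table k n) θ).toLinearMap)

/-- The model has dimension `d`: the set of represented conditional distributions has (Hausdorff)
dimension `d`, and `d` is the maximum of the rank of the Jacobian of the parametrization. -/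
def HasDimension (k n m d : ℕ) : Prop :=
  dimH (model k n m) = (d : ENNReal) ∧
    IsGreatest (Set.range (jacobianRank : Param k n m → ℕ)) d

theorem partitionFn_pos {k n m : ℕ} (θ : Param k n m) (x : State k) : 0 < partitionFn θ x :=
  Finset.sum_pos (fun _ _ => Finset.sum_pos (fun _ _ => Real.exp_pos _) Finset.univ_nonempty)
    Finset.univ_nonempty

theorem condProb_mem {k n m : ℕ} (θ : Param k n m) : condProb θ ∈ condDistributions k n := by
  intro x
  have hZ := partitionFn_pos θ x
  refine ⟨fun y => mul_nonneg (by positivity)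
    (Finset.sum_nonneg fun _ _ => (Real.exp_pos _).le), ?_⟩
  simp only [condProb]
  rw [← Finset.mul_sum]
  exact one_div_mul_cancel hZ.ne'

theorem model_eq_range (k n m : ℕ) :
    model k n m = Set.range (condProb : Param k n m → Table k n) := by
  ext p
  constructor
  · rintro ⟨_, θ, rfl⟩
    exact ⟨θ, rfl⟩
  · rintro ⟨θ, rfl⟩
    exact ⟨condProb_mem θ, θ, rfl⟩

/-- The parametrization is smooth, so that its Jacobian is a genuine derivative. -/
theorem contDiff_condProb (k n m : ℕ) :
    ContDiff ℝ (⊤ : ℕ∞) (condProb : Param k n m → Table k n) := by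
  have he : ∀ (x : State k) (y : State n) (z : State m),
      ContDiff ℝ (⊤ : ℕ∞) (fun θ : Param k n m => energy θ x y z) := by
    intro x y z
    unfold energy
    fun_prop
  rw [contDiff_pi]
  intro x
  rw [contDiff_pi]
  intro y
  unfold condProb
  refine ContDiff.mul (ContDiff.div contDiff_const ?_ fun θ => (partitionFn_pos θ x).ne') ?_
  · unfold partitionFn
    exact ContDiff.sum fun y _ => ContDiff.sum fun z _ => (he x y z).exp
  · exact ContDiff.sum fun z _ => (he x y z).exp

end CRBM

namespace CRBM

open Filter Topology

variable {k n m : ℕ}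

/-! Summing out the hidden units turns `log p(y|x)`, up to a function of `x`, into a linear term in
`y` plus softplus terms of affine functions of `(x, y)`. The derivative weights each hidden unit's
affine functions by sigmoids. When the parameters are scaled to infinity these become indicators of
half-spaces of the cube of visible states, and lower semicontinuity of rank makes the rank of this
combinatorial limit a lower bound for the maximal Jacobian rank (`exists_le_jacobianRank`).
Parameter count and polytope dimension bound the rank and the Hausdorff dimension from above, and
each Jacobian rank bounds the Hausdorff dimension from below. It remains to choose good half-spaces,
in practice Hamming balls around codewords.

For few hidden units, balls around a code of minimum distance four are disjoint, and an affine
function vanishing on a ball is zero. The functions of `x` lost to normalization are controlled by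
an uncovered entry in each row (`hasDimension_of_code`, at least two outputs). For one output the
code lives in the inputs and weighted balls are used (`hasDimension_of_code_single_output`). Four
visible and two hidden units, with at least two outputs, need an explicit pair of half-spaces
(`eq_zero_of_two_slices`).

For many hidden units, balls of radius one around a covering code meet every entry, and affine
functions interpolate arbitrary values on a ball, so the limiting tangent space is everything
(`hasDimension_of_covering`). The exceptional triples have full dimension by nearly complete
coverings. -/

/-! ### The unnormalized log-probability and its derivative -/

/-- The total input to the hidden unit `i`, as a function of the parameters. -/
noncomputable def hiddenInput (i : Fin m) (x : State k) (y : State n) : Param k n m →L[ℝ] ℝ :=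
  LinearMap.toContinuousLinearMap
    { toFun := fun θ => (∑ j, θ.2.1 i j * bit (x j)) + (∑ j, θ.1 i j * bit (y j)) + θ.2.2.2 i
      map_add' := by
        intro θ θ'
        simp only [Prod.fst_add, Prod.snd_add, Pi.add_apply, add_mul, Finset.sum_add_distrib]
        ring
      map_smul' := by
        intro a θ
        simp only [Prod.smul_fst, Prod.smul_snd, Pi.smul_apply, smul_eq_mul, RingHom.id_apply,
          mul_add, Finset.mul_sum, mul_assoc] }

theorem hiddenInput_apply (i : Fin m) (x : State k) (y : State n) (θ : Param k n m) :
    hiddenInput i x y θ =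
      (∑ j, θ.2.1 i j * bit (x j)) + (∑ j, θ.1 i j * bit (y j)) + θ.2.2.2 i := rfl

/-- The linear contribution of the output biases to the log-probability of `y`. -/
noncomputable def outputBias (y : State n) : Param k n m →L[ℝ] ℝ :=
  LinearMap.toContinuousLinearMap
    { toFun := fun θ => ∑ j, θ.2.2.1 j * bit (y j)
      map_add' := by
        intro θ θ'
        simp only [Prod.fst_add, Prod.snd_add, Pi.add_apply, add_mul, Finset.sum_add_distrib]
      map_smul' := by
        intro a θ
        simp only [Prod.smul_fst, Prod.smul_snd, Pi.smul_apply, smul_eq_mul, RingHom.id_apply,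
          Finset.mul_sum, mul_assoc] }

theorem outputBias_apply (y : State n) (θ : Param k n m) :
    outputBias y θ = ∑ j, θ.2.2.1 j * bit (y j) := rfl

/-- The unnormalized log-probability. -/
noncomputable def score (θ : Param k n m) : Table k n := fun x y =>
  outputBias y θ + ∑ i, Real.log (1 + Real.exp (hiddenInput i x y θ))

/-- Hidden units are not coupled to each other, so the sum over `z` factorizes into two-term sums,
one per unit. -/
theorem sum_exp_energy (θ : Param k n m) (x : State k) (y : State n) :
    ∑ z : State m, Real.exp (energy θ x y z) = Real.exp (score θ x y) := by
  have h1 : ∀ z : State m, Real.exp (energy θ x y z) =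
      Real.exp (outputBias y θ) * ∏ i, Real.exp (bit (z i) * hiddenInput i x y θ) := by
    intro z
    rw [← Real.exp_sum, ← Real.exp_add]
    congr 1
    simp only [energy, hiddenInput_apply, outputBias_apply, mul_add, Finset.sum_add_distrib,
      Finset.mul_sum, mul_assoc]
    have : ∀ i, bit (z i) * θ.2.2.2 i = θ.2.2.2 i * bit (z i) := fun i => mul_comm _ _
    simp only [this]
    ring
  simp only [h1]
  rw [← Finset.mul_sum, score, Real.exp_add, Real.exp_sum,
    ← Fintype.prod_sum (fun i (a : Fin 2) => Real.exp (bit a * hiddenInput i x y θ))]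
  congr 1
  refine Finset.prod_congr rfl fun i _ => ?_
  rw [Real.exp_log (by positivity)]
  simp [Fin.sum_univ_two, bit]

theorem condProb_pos (θ : Param k n m) (x : State k) (y : State n) : 0 < condProb θ x y := by
  have := partitionFn_pos θ x
  simp only [condProb, sum_exp_energy]
  positivity

/-- An entry of a table, as a continuous linear map. -/
noncomputable def entry (x : State k) (y : State n) : Table k n →L[ℝ] ℝ :=
  (ContinuousLinearMap.proj y : (State n → ℝ) →L[ℝ] ℝ).comp
    (ContinuousLinearMap.proj x : Table k n →L[ℝ] (State n → ℝ))

@[simp] theorem entry_apply (x : State k) (y : State n) (g : Table k n) :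
    entry x y g = g x y := rfl

/-- The difference of the entries of a table with those in the column of `y = 0`. -/
noncomputable def contrast (k n : ℕ) : Table k n →L[ℝ] Table k n :=
  ContinuousLinearMap.pi fun x => ContinuousLinearMap.pi fun y =>
    entry x y - entry x 0

@[simp] theorem contrast_apply (g : Table k n) (x : State k) (y : State n) :
    contrast k n g x y = g x y - g x 0 := rfl

/-- The log-partition function depends on `x` alone, and `contrast` annihilates such tables. -/
theorem contrast_log_condProb (θ : Param k n m) :
    contrast k n (fun x y => Real.log (condProb θ x y)) = contrast k n (score θ) := by
  ext x y
  have := partitionFn_pos θ x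
  simp only [contrast_apply, condProb, sum_exp_energy]
  rw [Real.log_mul (by positivity) (by positivity), Real.log_mul (by positivity) (by positivity),
    Real.log_exp, Real.log_exp]
  ring

/-- The derivative of the score when the hidden units have activities `s`. -/
noncomputable def featureMap (s : Fin m → State k → State n → ℝ) : Param k n m →L[ℝ] Table k n :=
  ContinuousLinearMap.pi fun x => ContinuousLinearMap.pi fun y =>
    outputBias y + ∑ i, s i x y • hiddenInput i x y

theorem featureMap_apply (s : Fin m → State k → State n → ℝ) (θ : Param k n m) (x : State k)
    (y : State n) : featureMap s θ x y = outputBias y θ + ∑ i, s i x y * hiddenInput i x y θ := by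
  simp [featureMap]

theorem continuous_featureMap :
    Continuous (featureMap : (Fin m → State k → State n → ℝ) → Param k n m →L[ℝ] Table k n) := by
  rw [continuous_clm_apply]
  intro θ
  refine continuous_pi fun x => continuous_pi fun y => ?_
  simp only [featureMap_apply]
  fun_prop

theorem hasDerivAt_softplus (a : ℝ) :
    HasDerivAt (fun t => Real.log (1 + Real.exp t)) (Real.sigmoid a) a := by
  have h := ((Real.hasDerivAt_exp a).const_add 1).log (by positivity)
  convert h using 1
  rw [Real.sigmoid_def, Real.exp_neg]
  have := Real.exp_pos a
  field_simp
  ring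

theorem hasFDerivAt_score (θ : Param k n m) :
    HasFDerivAt (score : Param k n m → Table k n)
      (featureMap fun i x y => Real.sigmoid (hiddenInput i x y θ)) θ := by
  rw [featureMap, hasFDerivAt_pi]
  intro x
  rw [hasFDerivAt_pi]
  intro y
  refine (outputBias y).hasFDerivAt.add (HasFDerivAt.fun_sum fun i _ => ?_)
  exact (hasDerivAt_softplus _).comp_hasFDerivAt θ (hiddenInput i x y).hasFDerivAt

/-- Differentiating `contrast_log_condProb` shows that the derivative of the contrasted score
factors through the Jacobian of `condProb`. -/
theorem finrank_range_le_jacobianRank (θ : Param k n m) :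
    Module.finrank ℝ (LinearMap.range ((contrast k n).comp
      (featureMap fun i x y => Real.sigmoid (hiddenInput i x y θ))).toLinearMap) ≤
      jacobianRank θ := by
  set J := fderiv ℝ (condProb : Param k n m → Table k n) θ with hJ
  have hJd : HasFDerivAt (condProb : Param k n m → Table k n) J θ :=
    ((contDiff_condProb k n m).differentiable (by simp) θ).hasFDerivAt
  let D : Table k n →L[ℝ] Table k n := ContinuousLinearMap.pi fun x => ContinuousLinearMap.pi
    fun y => (condProb θ x y)⁻¹ • entry x y
  have hlog : HasFDerivAt (fun θ' : Param k n m => (fun x y => Real.log (condProb θ' x y) :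
      Table k n)) (D.comp J) θ := by
    rw [hasFDerivAt_pi']
    intro x
    rw [hasFDerivAt_pi']
    intro y
    have hxy : HasFDerivAt (fun θ' : Param k n m => condProb θ' x y) _ θ :=
      hasFDerivAt_pi'.1 (hasFDerivAt_pi'.1 hJd x) y
    exact hxy.log (condProb_pos θ x y).ne'
  have h1 := (contrast k n).hasFDerivAt.comp θ hlog
  have h2 := (contrast k n).hasFDerivAt.comp θ (hasFDerivAt_score θ)
  have h3 : (⇑(contrast k n) ∘ fun θ' : Param k n m => (fun x y => Real.log (condProb θ' x y) :
      Table k n)) = ⇑(contrast k n) ∘ score := funext fun θ' => contrast_log_condProb θ'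
  rw [h3] at h1
  rw [h2.unique h1]
  have h4 : (((contrast k n).comp (D.comp J)).toLinearMap) =
      ((contrast k n).comp D).toLinearMap ∘ₗ J.toLinearMap := rfl
  rw [h4, LinearMap.range_comp]
  exact Submodule.finrank_map_le _ _

/-! ### The limit of infinitely large parameters -/

/-- The activities of the hidden units when the parameters are scaled to infinity. -/
noncomputable def slicing (θ : Param k n m) : Fin m → State k → State n → ℝ := fun i x y =>
  if 0 < hiddenInput i x y θ then 1 else 0

theorem tendsto_sigmoid_smul (θ : Param k n m) (hθ : ∀ i x y, hiddenInput i x y θ ≠ 0) :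
    Tendsto (fun t : ℝ => fun i x y => Real.sigmoid (hiddenInput i x y (t • θ))) atTop
      (𝓝 (slicing θ)) := by
  rw [tendsto_pi_nhds]; intro i
  rw [tendsto_pi_nhds]; intro x
  rw [tendsto_pi_nhds]; intro y
  simp only [map_smul, smul_eq_mul, slicing]
  split_ifs with h
  · exact Real.tendsto_sigmoid_atTop.comp (tendsto_id.atTop_mul_const h)
  · exact Real.tendsto_sigmoid_atBot.comp
      (tendsto_id.atTop_mul_const_of_neg (lt_of_le_of_ne (not_lt.1 h) (hθ i x y)))

/-- Scaling drives the sigmoids to 0 or 1 while the linear maps they multiply stay fixed. Having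
rank at least `r` is an open condition, so a large finite scale retains the limiting rank. -/
theorem exists_le_jacobianRank (θ : Param k n m) (hθ : ∀ i x y, hiddenInput i x y θ ≠ 0) :
    ∃ θ' : Param k n m, Module.finrank ℝ (LinearMap.range
      ((contrast k n).comp (featureMap (slicing θ))).toLinearMap) ≤ jacobianRank θ' := by
  set r := Module.finrank ℝ (LinearMap.range
      ((contrast k n).comp (featureMap (slicing θ))).toLinearMap) with hr
  have hc : Continuous fun s : Fin m → State k → State n → ℝ =>
      (contrast k n).comp (featureMap s) :=
    continuous_const.clm_comp continuous_featureMap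
  have ho := isOpen_setOfPred_nat_le_rank (𝕜 := ℝ) (E := Param k n m) (F := Table k n) r
  have hrank : ∀ f : Param k n m →L[ℝ] Table k n, (r : Cardinal) ≤ (f : Param k n m →ₗ[ℝ] Table k n).rank ↔
      r ≤ Module.finrank ℝ (LinearMap.range f.toLinearMap) := by
    intro f
    rw [LinearMap.rank, ← Module.finrank_eq_rank, Nat.cast_le]
  have hmem : ∀ᶠ f : Param k n m →L[ℝ] Table k n in
      𝓝 ((contrast k n).comp (featureMap (slicing θ))),
      (r : Cardinal) ≤ (f : Param k n m →ₗ[ℝ] Table k n).rank :=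
    ho.mem_nhds ((hrank _).2 hr.le)
  obtain ⟨t, ht⟩ := (((hc.tendsto _).comp (tendsto_sigmoid_smul θ hθ)).eventually hmem).exists
  exact ⟨t • θ, ((hrank _).1 ht).trans (finrank_range_le_jacobianRank _)⟩

/-! ### Upper bounds, and rank versus Hausdorff dimension -/

theorem finrank_param (k n m : ℕ) : Module.finrank ℝ (Param k n m) = (n + k + 1) * m + n := by
  simp [Param, Module.finrank_prod, Module.finrank_pi_fintype]
  ring

theorem jacobianRank_le_card_param (θ : Param k n m) : jacobianRank θ ≤ (n + k + 1) * m + n := by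
  rw [← finrank_param]
  exact LinearMap.finrank_range_le _

/-- The table of a conditional distribution, from its entries at the outputs `y ≠ 0`. -/
noncomputable def fillTable (k n : ℕ) (r : State k → {y : State n // y ≠ 0} → ℝ) : Table k n :=
  fun x y => if h : y = 0 then 1 - ∑ y', r x y' else r x ⟨y, h⟩

theorem contDiff_fillTable (k n : ℕ) : ContDiff ℝ 1 (fillTable k n) := by
  rw [contDiff_pi]; intro x
  rw [contDiff_pi]; intro y
  unfold fillTable
  split_ifs <;> fun_prop

theorem fillTable_restrict {p : Table k n} (hp : p ∈ condDistributions k n) :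
    fillTable k n (fun x y => p x y) = p := by
  ext x y
  unfold fillTable
  split_ifs with h
  · subst h
    rw [← (hp x).2, Fintype.sum_eq_add_sum_subtype_ne _ (0 : State n)]
    ring
  · rfl

theorem finrank_free_entries (k n : ℕ) :
    Module.finrank ℝ (State k → {y : State n // y ≠ 0} → ℝ) = 2 ^ k * (2 ^ n - 1) := by
  simp [Module.finrank_pi_fintype, Fintype.card_subtype_compl]

/-- Rows sum to one, so the parametrization factors smoothly through the entries with `y ≠ 0`. -/
theorem jacobianRank_le_card_entries (θ : Param k n m) : jacobianRank θ ≤ 2 ^ k * (2 ^ n - 1) := by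
  let R : Table k n →L[ℝ] (State k → {y : State n // y ≠ 0} → ℝ) :=
    ContinuousLinearMap.pi fun x => ContinuousLinearMap.pi fun y =>
      entry x y.1
  have hJd := ((contDiff_condProb k n m).differentiable (by simp) θ).hasFDerivAt
  have hT := ((contDiff_fillTable k n).differentiable (by simp) (R (condProb θ))).hasFDerivAt
  have h := hT.comp θ (R.hasFDerivAt.comp θ hJd)
  have he : (fillTable k n ∘ R ∘ condProb : Param k n m → Table k n) = condProb :=
    funext fun θ' => fillTable_restrict (condProb_mem θ')
  rw [he] at h
  rw [jacobianRank, h.fderiv, ← finrank_free_entries]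
  have h4 : ∀ (A : (State k → {y : State n // y ≠ 0} → ℝ) →L[ℝ] Table k n)
      (B : Param k n m →L[ℝ] (State k → {y : State n // y ≠ 0} → ℝ)),
      Module.finrank ℝ (LinearMap.range (A.comp B).toLinearMap) ≤
        Module.finrank ℝ (State k → {y : State n // y ≠ 0} → ℝ) := by
    intro A B
    refine (Submodule.finrank_mono (LinearMap.range_comp_le_range B.toLinearMap A.toLinearMap)).trans
      (LinearMap.finrank_range_le _)
  exact h4 _ _

theorem dimH_model_le (k n m : ℕ) :
    dimH (model k n m) ≤ (min ((n + k + 1) * m + n) (2 ^ k * (2 ^ n - 1)) : ℕ) := by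
  rw [(Nat.mono_cast (α := ENNReal)).map_min]
  refine le_min ?_ ?_
  · rw [model_eq_range, ← finrank_param]
    exact ((contDiff_condProb k n m).of_le (by exact_mod_cast le_top)).dimH_range_le
  · rw [← finrank_free_entries]
    refine (dimH_mono ?_).trans (contDiff_fillTable k n).dimH_range_le
    rintro p ⟨hp, -⟩
    exact ⟨_, fillTable_restrict hp⟩

/-- Projecting onto the range of the Jacobian makes the derivative surjective, so the projected
model contains a neighbourhood in a space of that dimension. Lipschitz maps do not raise Hausdorff
dimension. -/
theorem jacobianRank_le_dimH (θ : Param k n m) : (jacobianRank θ : ENNReal) ≤ dimH (model k n m) := by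
  set J := fderiv ℝ (condProb : Param k n m → Table k n) θ with hJ
  obtain ⟨q, hq⟩ := (LinearMap.range J.toLinearMap).exists_isCompl
  let Q : Table k n →L[ℝ] LinearMap.range J.toLinearMap :=
    LinearMap.toContinuousLinearMap (Submodule.projectionOnto _ q hq)
  have hQ : ∀ v, Q (J v) = ⟨J v, v, rfl⟩ := fun v =>
    Submodule.projectionOnto_apply_left hq ⟨J v, v, rfl⟩
  have hs : HasStrictFDerivAt (condProb : Param k n m → Table k n) J θ :=
    (contDiff_condProb k n m).contDiffAt.hasStrictFDerivAt (by simp)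
  have hQs := Q.hasStrictFDerivAt.comp θ hs
  have hsurj : LinearMap.range (Q.comp J).toLinearMap = ⊤ := by
    rw [LinearMap.range_eq_top]
    rintro ⟨_, v, rfl⟩
    exact ⟨v, hQ v⟩
  have hn := hQs.map_nhds_eq_of_surj hsurj
  have hmem : Q '' model k n m ∈ 𝓝 (Q (condProb θ)) := by
    rw [← hn, model_eq_range, ← Set.range_comp]
    exact Filter.mem_map.2 (Filter.univ_mem' fun θ' => ⟨θ', rfl⟩)
  have hd := Real.dimH_of_mem_nhds hmem
  calc (jacobianRank θ : ENNReal) = dimH (Q '' model k n m) := hd.symm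
    _ ≤ dimH (model k n m) := Q.lipschitz.dimH_image_le _

theorem hasDimension_of_le_jacobianRank (θ : Param k n m)
    (h : min ((n + k + 1) * m + n) (2 ^ k * (2 ^ n - 1)) ≤ jacobianRank θ) :
    HasDimension k n m (min ((n + k + 1) * m + n) (2 ^ k * (2 ^ n - 1))) := by
  have hle : ∀ θ' : Param k n m,
      jacobianRank θ' ≤ min ((n + k + 1) * m + n) (2 ^ k * (2 ^ n - 1)) := fun θ' =>
    le_min (jacobianRank_le_card_param θ') (jacobianRank_le_card_entries θ')
  refine ⟨(dimH_model_le k n m).antisymm ?_, ⟨θ, (hle θ).antisymm h⟩, ?_⟩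
  · exact (Nat.cast_le.2 h).trans (jacobianRank_le_dimH θ)
  · rintro _ ⟨θ', rfl⟩
    exact hle θ'

/-! ### Linear-algebra criteria for the expected dimension -/

/-- The model has the dimension of its parameter space as soon as the tangent map of some
slicing is injective modulo functions of the input. -/
theorem hasDimension_of_injective (θ : Param k n m) (hθ : ∀ i x y, hiddenInput i x y θ ≠ 0)
    (hinj : ∀ (η : Param k n m) (f : State k → ℝ),
      (∀ x y, featureMap (slicing θ) η x y = f x) → η = 0) :
    HasDimension k n m ((n + k + 1) * m + n) ∧
      HasDimension k n m (min ((n + k + 1) * m + n) (2 ^ k * (2 ^ n - 1))) := by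
  obtain ⟨θ', h⟩ := exists_le_jacobianRank θ hθ
  rw [LinearMap.finrank_range_of_inj, finrank_param] at h
  -- No separate count is needed: full column rank at `θ'` already forces the parameter number below
  -- the polytope dimension.
  · have hmin : min ((n + k + 1) * m + n) (2 ^ k * (2 ^ n - 1)) = (n + k + 1) * m + n :=
      min_eq_left (h.trans (jacobianRank_le_card_entries θ'))
    have := hasDimension_of_le_jacobianRank θ' (hmin.le.trans h)
    exact ⟨hmin ▸ this, this⟩
  · refine (injective_iff_map_eq_zero _).2 fun η hη => ?_
    refine hinj η (fun x => featureMap (slicing θ) η x 0) fun x y => ?_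
    have : contrast k n (featureMap (slicing θ) η) x y = 0 := congrFun (congrFun hη x) y
    exact sub_eq_zero.1 this

/-- The functions of the input alone, as tables. -/
noncomputable def inputTables (k n : ℕ) : (State k → ℝ) →ₗ[ℝ] Table k n where
  toFun f := fun x _ => f x
  map_add' _ _ := rfl
  map_smul' _ _ := rfl

theorem table_eq_sum_single (g : Table k n) :
    g = ∑ x, ∑ y, g x y • (Pi.single x (Pi.single y 1) : Table k n) := by
  ext x y
  simp [Finset.sum_apply, Pi.single_apply, ite_apply]

/-- By duality: a proper subspace is killed by a nonzero functional, which is pairing with a table;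
vanishing on functions of `x` means that its row sums are zero. -/
theorem sup_inputTables_eq_top (θ : Param k n m)
    (hann : ∀ l : Table k n, (∀ x, ∑ y, l x y = 0) →
      (∀ η, ∑ x, ∑ y, l x y * featureMap (slicing θ) η x y = 0) → l = 0) :
    LinearMap.range (featureMap (slicing θ)).toLinearMap ⊔ LinearMap.range (inputTables k n) =
      ⊤ := by
  by_contra hne
  obtain ⟨φ, hφ0, hφ⟩ := Submodule.exists_le_ker_of_lt_top _ (lt_top_iff_ne_top.2 hne)
  set l : Table k n := fun x y => φ (Pi.single x (Pi.single y 1)) with hl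
  have hφl : ∀ g, φ g = ∑ x, ∑ y, l x y * g x y := by
    intro g
    conv_lhs => rw [table_eq_sum_single g]
    simp [hl, map_sum, mul_comm]
  have hl0 : l = 0 := by
    refine hann l (fun x => ?_) fun η => ?_
    · have h0 : φ (inputTables k n (Pi.single x 1)) = 0 :=
        hφ (Submodule.mem_sup_right ⟨_, rfl⟩)
      rw [hφl, Finset.sum_eq_single x] at h0
      · simpa [inputTables] using h0
      · intro x' _ hx'
        simp [inputTables, Pi.single_eq_of_ne hx']
      · simp
    · rw [← hφl]
      exact hφ (Submodule.mem_sup_left ⟨η, rfl⟩)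
  refine hφ0 (LinearMap.ext fun g => ?_)
  rw [hφl, hl0]
  simp

/-- The model has the dimension of the polytope of conditional distributions as soon as the only
table that sums to zero in each row and is orthogonal to the tangent space of some slicing is
zero. -/
theorem hasDimension_of_annihilator (θ : Param k n m) (hθ : ∀ i x y, hiddenInput i x y θ ≠ 0)
    (hann : ∀ l : Table k n, (∀ x, ∑ y, l x y = 0) →
      (∀ η, ∑ x, ∑ y, l x y * featureMap (slicing θ) η x y = 0) → l = 0) :
    HasDimension k n m (2 ^ k * (2 ^ n - 1)) ∧
      HasDimension k n m (min ((n + k + 1) * m + n) (2 ^ k * (2 ^ n - 1))) := by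
  obtain ⟨θ', h⟩ := exists_le_jacobianRank θ hθ
  have hF : 2 ^ k * (2 ^ n - 1) ≤ jacobianRank θ' := by
    refine le_trans ?_ h
    -- `contrast` kills `inputTables`, so the tangent space alone already has the same image as the
    -- whole space.
    have hr : LinearMap.range ((contrast k n).comp (featureMap (slicing θ))).toLinearMap =
        LinearMap.range (contrast k n).toLinearMap := by
      refine le_antisymm (LinearMap.range_comp_le_range _ _) ?_
      rintro _ ⟨g, rfl⟩
      have hg : g ∈ LinearMap.range (featureMap (slicing θ)).toLinearMap ⊔
          LinearMap.range (inputTables k n) := by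
        rw [sup_inputTables_eq_top θ hann]
        trivial
      obtain ⟨_, ⟨η, rfl⟩, _, ⟨f, rfl⟩, rfl⟩ := Submodule.mem_sup.1 hg
      refine ⟨η, ?_⟩
      ext x y
      simp [inputTables]
    rw [hr, ← finrank_free_entries]
    let R : Table k n →L[ℝ] (State k → {y : State n // y ≠ 0} → ℝ) :=
      ContinuousLinearMap.pi fun x => ContinuousLinearMap.pi fun y => entry x y.1
    have hR : Submodule.map R.toLinearMap (LinearMap.range (contrast k n).toLinearMap) = ⊤ := by
      refine eq_top_iff.2 fun g _ => ?_
      refine ⟨_, ⟨fun x y => if h : y = 0 then 0 else g x ⟨y, h⟩, rfl⟩, ?_⟩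
      ext x y
      change (contrast k n _) x y.1 = _
      simp [y.2]
    rw [← finrank_top ℝ (State k → {y : State n // y ≠ 0} → ℝ), ← hR]
    exact Submodule.finrank_map_le _ _
  have hmin : min ((n + k + 1) * m + n) (2 ^ k * (2 ^ n - 1)) = 2 ^ k * (2 ^ n - 1) :=
    min_eq_right (hF.trans (jacobianRank_le_card_param θ'))
  have := hasDimension_of_le_jacobianRank θ' (hmin.le.trans hF)
  exact ⟨hmin ▸ this, this⟩

/-! ### Flips and Hamming distance in the binary cube -/

variable {ι : Type*}

/-- Flip the coordinate `j` of a binary vector. -/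
def flip [DecidableEq ι] (v : ι → Fin 2) (j : ι) : ι → Fin 2 := Function.update v j (v j + 1)

theorem flip_same [DecidableEq ι] (v : ι → Fin 2) (j : ι) : flip v j j = v j + 1 := by simp [flip]

theorem flip_of_ne [DecidableEq ι] (v : ι → Fin 2) {i j : ι} (h : i ≠ j) : flip v j i = v i := by simp [flip, h]

theorem flip_flip [DecidableEq ι] (v : ι → Fin 2) (j : ι) : flip (flip v j) j = v := by
  ext i
  rcases eq_or_ne i j with rfl | h
  · rw [flip_same, flip_same, add_assoc, show (1 + 1 : Fin 2) = 0 from rfl, add_zero]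
  · rw [flip_of_ne _ h, flip_of_ne _ h]

theorem flip_comm [DecidableEq ι] (v : ι → Fin 2) (p q : ι) :
    flip (flip v p) q = flip (flip v q) p := by
  rcases eq_or_ne p q with rfl | h
  · rfl
  · unfold flip
    rw [Function.update_of_ne h.symm, Function.update_of_ne h, Function.update_comm h.symm]

theorem flip_injective [DecidableEq ι] (p : ι) :
    Function.Injective fun v : ι → Fin 2 => flip v p := fun v v' h => by
  rw [← flip_flip v p, ← flip_flip v' p]
  exact congrArg (flip · p) h

theorem add_single_eq_flip [DecidableEq ι] (v : ι → ZMod 2) (j : ι) :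
    @Eq (ι → ZMod 2) (v + Pi.single j 1) (flip v j) := by
  funext i
  rcases eq_or_ne i j with rfl | h
  · have h1 : (v + Pi.single i 1 : ι → ZMod 2) i = v i + 1 := by simp
    exact h1.trans (flip_same v i).symm
  · have h1 : (v + Pi.single j 1 : ι → ZMod 2) i = v i := by simp [h]
    exact h1.trans (flip_of_ne v h).symm

variable [Fintype ι]

theorem hammingDist_flip [DecidableEq ι] (v : ι → Fin 2) (j : ι) : hammingDist v (flip v j) = 1 := by
  rw [hammingDist, Finset.card_eq_one]
  refine ⟨j, ?_⟩
  ext i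
  rcases eq_or_ne i j with rfl | h
  · have : ∀ a : Fin 2, a ≠ a + 1 := by decide
    simp [flip_same, this]
  · simp [flip_of_ne _ h, h]

theorem hammingDist_add_single [DecidableEq ι] (v : ι → ZMod 2) (j : ι) :
    hammingDist v (v + Pi.single j 1) = 1 := by
  rw [add_single_eq_flip]
  exact hammingDist_flip v j

theorem sum_flip [DecidableEq ι] (v : ι → ZMod 2) (j : ι) :
    @Eq (ZMod 2) (∑ i, @id (ι → ZMod 2) (flip v j) i) ((∑ i, v i) + 1) := by
  rw [← add_single_eq_flip]
  simp [Finset.sum_add_distrib]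

theorem hammingDist_flip_flip [DecidableEq ι] (v : ι → Fin 2) {i j : ι} (h : i ≠ j) :
    hammingDist v (flip (flip v i) j) = 2 := by
  rw [hammingDist, Finset.card_eq_two]
  refine ⟨i, j, h, ?_⟩
  have hne : ∀ a : Fin 2, a ≠ a + 1 := by decide
  ext l
  rcases eq_or_ne l j with rfl | hj
  · simp [flip_same, flip_of_ne _ h.symm, hne]
  · rcases eq_or_ne l i with rfl | hi
    · simp [flip_same, flip_of_ne _ h, hne]
    · simp [flip_of_ne _ hi, flip_of_ne _ hj, hi, hj]

theorem exists_eq_flip_of_hammingDist_eq_one [DecidableEq ι] {v w : ι → Fin 2} (h : hammingDist v w = 1) :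
    ∃ j, w = flip v j := by
  obtain ⟨j, hj⟩ := Finset.card_eq_one.1 h
  refine ⟨j, funext fun i => ?_⟩
  have hi : v i ≠ w i ↔ i = j := by simpa using congrArg (i ∈ ·) hj
  have h2 : ∀ a b : Fin 2, a ≠ b → b = a + 1 := by decide
  rcases eq_or_ne i j with rfl | hij
  · rw [flip_same]
    exact h2 _ _ (hi.2 rfl)
  · rw [flip_of_ne _ hij]
    by_contra hne
    exact hij (hi.1 fun h' => hne h'.symm)

theorem exists_eq_flip_flip_of_hammingDist_eq_two [DecidableEq ι]
    {v w : ι → Fin 2} (h : hammingDist v w = 2) :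
    ∃ i j, i ≠ j ∧ w = flip (flip v i) j := by
  obtain ⟨i, j, hij, hs⟩ := Finset.card_eq_two.1 h
  refine ⟨i, j, hij, funext fun l => ?_⟩
  have hl : v l ≠ w l ↔ l = i ∨ l = j := by simpa using congrArg (l ∈ ·) hs
  have h2 : ∀ a b : Fin 2, a ≠ b → b = a + 1 := by decide
  rcases eq_or_ne l j with rfl | hj
  · rw [flip_same, flip_of_ne _ hij.symm]
    exact h2 _ _ (hl.2 (Or.inr rfl))
  · rw [flip_of_ne _ hj]
    rcases eq_or_ne l i with rfl | hi
    · rw [flip_same]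
      exact h2 _ _ (hl.2 (Or.inl rfl))
    · rw [flip_of_ne _ hi]
      by_contra hne
      exact (hl.1 fun h' => hne h'.symm).elim hi hj

theorem natCast_hammingDist (v w : ι → ZMod 2) : (hammingDist v w : ZMod 2) = ∑ j, (v j - w j) := by
  have h : ∀ a b : ZMod 2, a - b = if a ≠ b then 1 else 0 := by decide
  simp only [h, Finset.sum_boole]
  rfl

/-! ### Packing and covering codes -/

/-- A linear map with prescribed images of the coordinate vectors. -/
noncomputable def syndrome {r : ℕ} (label : ι → Fin r → ZMod 2) :
    (ι → ZMod 2) →ₗ[ZMod 2] (Fin r → ZMod 2) := Fintype.linearCombination (ZMod 2) label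

theorem syndrome_apply {r : ℕ} (label : ι → Fin r → ZMod 2) (v : ι → ZMod 2) :
    syndrome label v = ∑ j, v j • label j := rfl

/-- There is a code of even weight and minimum distance four of the size of an extended (shortened)
Hamming code. -/
theorem exists_even_code {m s : ℕ} (hs : Fintype.card ι ≤ 2 ^ s)
    (hm : m * 2 ^ (s + 1) ≤ 2 ^ Fintype.card ι) :
    ∃ c : Fin m → ι → ZMod 2, (∀ i, ∑ j, c i j = 0) ∧
      ∀ i i', i ≠ i' → 4 ≤ hammingDist (c i) (c i') := by
  classical
  obtain ⟨label⟩ : Nonempty (ι ↪ (Fin s → ZMod 2)) :=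
    Function.Embedding.nonempty_of_card_le (by simpa [ZMod.card] using hs)
  -- A parity check with `s + 1` rows: the overall parity makes all distances even, and the distinct
  -- labels exclude distance two.
  let H : (ι → ZMod 2) →ₗ[ZMod 2] ZMod 2 × (Fin s → ZMod 2) :=
    (∑ j, LinearMap.proj j).prod (syndrome label)
  have hH : ∀ v, v ∈ LinearMap.ker H ↔ ∑ j, v j = 0 ∧ ∑ j, v j • label j = 0 := by
    intro v
    simp [H, syndrome_apply]
  have : Fintype (LinearMap.ker H) := Fintype.ofFinite _
  have hcard : m ≤ Fintype.card (LinearMap.ker H) := by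
    have h1 := LinearMap.finrank_range_add_finrank_ker H
    have h2 := Submodule.finrank_le (LinearMap.range H)
    simp only [Module.finrank_prod, Module.finrank_self, Module.finrank_fintype_fun_eq_card,
      Fintype.card_fin] at h1 h2
    rw [Module.card_eq_pow_finrank (K := ZMod 2), ZMod.card]
    rw [← h1, pow_add _ _ (Module.finrank (ZMod 2) (LinearMap.ker H))] at hm
    have h3 : 2 ^ Module.finrank (ZMod 2) (LinearMap.range H) ≤ 2 ^ (s + 1) :=
      Nat.pow_le_pow_right two_pos (by omega)
    have h4 : 0 < 2 ^ (s + 1) := by positivity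
    refine Nat.le_of_mul_le_mul_right (hm.trans ?_) h4
    rw [mul_comm]
    exact Nat.mul_le_mul_left _ h3
  obtain ⟨c⟩ : Nonempty (Fin m ↪ LinearMap.ker H) :=
    Function.Embedding.nonempty_of_card_le (by simpa using hcard)
  refine ⟨fun i => (c i : ι → ZMod 2), fun i => ((hH _).1 (c i).2).1, fun i i' hne => ?_⟩
  set w : ι → ZMod 2 := (c i : ι → ZMod 2) - c i' with hw
  have hwk := (hH w).1 (sub_mem (c i).2 (c i').2)
  have hpar : (hammingDist (c i : ι → ZMod 2) (c i') : ZMod 2) = 0 := by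
    rw [natCast_hammingDist]
    exact hwk.1
  rw [ZMod.natCast_eq_zero_iff] at hpar
  have hpos : 0 < hammingDist (c i : ι → ZMod 2) (c i') :=
    hammingDist_pos.2 fun h => hne (c.injective (Subtype.ext h))
  by_contra! hlt
  change hammingDist (c i : ι → ZMod 2) (c i') < 4 at hlt
  have h2 : hammingDist (c i : ι → ZMod 2) (c i') = 2 := by omega
  obtain ⟨a, b, hab, hS⟩ := Finset.card_eq_two.1 h2
  have hwz : ∀ j, w j ≠ 0 ↔ j = a ∨ j = b := by
    intro j
    have : (c i : ι → ZMod 2) j ≠ (c i' : ι → ZMod 2) j ↔ j = a ∨ j = b := by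
      simpa using congrArg (j ∈ ·) hS
    rw [← this, hw, Pi.sub_apply, Ne, sub_eq_zero]
  have hone : ∀ x : ZMod 2, x ≠ 0 → x = 1 := by decide
  have hsum := hwk.2
  rw [Finset.sum_eq_add a b hab (fun j _ hj => by
    rw [not_not.1 (mt (hwz j).1 (by tauto)), zero_smul]) (by simp) (by simp),
    hone _ ((hwz a).2 (Or.inl rfl)), hone _ ((hwz b).2 (Or.inr rfl)), one_smul, one_smul] at hsum
  refine hab (label.injective (funext fun l => ?_))
  have := congrFun hsum l
  have hadd : ∀ x y : ZMod 2, x + y = 0 → x = y := by decide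
  exact hadd _ _ this

/-- There is a vector at distance at least three from all words of a small code of even weight. -/
theorem exists_far_vector [DecidableEq ι] [Nonempty ι] {m : ℕ} (c : Fin m → ι → ZMod 2)
    (hc : ∀ i, ∑ j, c i j = 0) (hm : 2 * (Fintype.card ι * m) < 2 ^ Fintype.card ι) :
    ∃ v : ι → Fin 2, ∀ i, 3 ≤ hammingDist v (c i) := by
  obtain ⟨j₀⟩ := ‹Nonempty ι›
  -- The image of `f` consists of the neighbours of codewords and their flips in `j₀`. A vector `w`
  -- outside it leaves both `w` and `flip w j₀` at distance other than one from the code; the one of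
  -- odd parity has odd distances, hence at least three.
  let f : Bool × (ι × Fin m) → ι → Fin 2 := fun p =>
    if p.1 then flip (c p.2.2) p.2.1 else flip (flip (c p.2.2) p.2.1) j₀
  have hns : ¬ Function.Surjective f := by
    intro hf
    have := Fintype.card_le_of_surjective f hf
    simp only [Fintype.card_prod, Fintype.card_bool, Fintype.card_fin, Fintype.card_fun] at this
    omega
  obtain ⟨w, hw⟩ := not_forall.1 hns
  have hne : ∀ v : ι → Fin 2, (v = w ∨ v = flip w j₀) → ∀ i j, v ≠ flip (c i) j := by
    rintro v (rfl | rfl) i j h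
    · exact hw ⟨(true, j, i), by simp [f, h]⟩
    · exact hw ⟨(false, j, i), by simp [f, ← h, flip_flip]⟩
  have hpar : ∀ v : ι → ZMod 2, (∀ i j, v ≠ flip (c i) j) → ∑ j, v j = 1 →
      ∀ i, 3 ≤ hammingDist v (c i) := by
    intro v hv h1 i
    have h : ((hammingDist v (c i) : ℕ) : ZMod 2) = (1 : ℕ) := by
      rw [natCast_hammingDist, Finset.sum_sub_distrib, h1, hc i]
      simp
    rw [ZMod.natCast_eq_natCast_iff] at h
    have h' : hammingDist v (c i) % 2 = 1 := h
    have : hammingDist v (c i) ≠ 1 := by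
      intro h1
      rw [hammingDist_comm] at h1
      obtain ⟨j, hj⟩ := exists_eq_flip_of_hammingDist_eq_one h1
      exact hv i j hj
    omega
  have hdich : ∀ x : ZMod 2, x = 1 ∨ x = 0 := by decide
  rcases hdich (∑ j, (w : ι → ZMod 2) j) with h | h
  · exact ⟨w, hpar w (hne w (Or.inl rfl)) h⟩
  · refine ⟨flip w j₀, hpar _ (hne _ (Or.inr rfl)) ?_⟩
    have h2 := sum_flip w j₀
    rw [h, zero_add] at h2
    exact h2

/-- There is a code of covering radius one of the size of a (lengthened) Hamming code. -/
theorem exists_covering_code {m r : ℕ} (hr : 2 ^ r ≤ Fintype.card ι + 1)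
    (hm : 2 ^ Fintype.card ι ≤ m * 2 ^ r) :
    ∃ c : Fin m → ι → Fin 2, ∀ v, ∃ i, hammingDist v (c i) ≤ 1 := by
  classical
  obtain ⟨e⟩ : Nonempty ({a : Fin r → ZMod 2 // a ≠ 0} ↪ ι) := by
    refine Function.Embedding.nonempty_of_card_le ?_
    rw [Fintype.card_subtype_compl]
    simp only [Fintype.card_fun, ZMod.card, Fintype.card_fin, Fintype.card_subtype_eq]
    omega
  -- Every nonzero syndrome is the label of some coordinate, so one flip corrects it; the surplus
  -- coordinates get label zero.
  let label : ι → Fin r → ZMod 2 := Function.extend e Subtype.val 0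
  have hlabel : ∀ a : {a : Fin r → ZMod 2 // a ≠ 0}, label (e a) = a.1 := fun a =>
    e.injective.extend_apply _ _ a
  have hsingle : ∀ j, syndrome label (Pi.single j 1) = label j := by
    intro j
    rw [syndrome_apply, Finset.sum_eq_single j (fun i _ hi => by simp [hi]) (by simp)]
    simp
  have hsurj : LinearMap.range (syndrome label) = ⊤ := by
    rw [LinearMap.range_eq_top]
    intro a
    by_cases ha : a = 0
    · exact ⟨0, by simp [ha]⟩
    · exact ⟨Pi.single (e ⟨a, ha⟩) 1, by rw [hsingle, hlabel]⟩
  have : Fintype (LinearMap.ker (syndrome label)) := Fintype.ofFinite _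
  have hcard : Fintype.card (LinearMap.ker (syndrome label)) ≤ m := by
    have h1 := LinearMap.finrank_range_add_finrank_ker (syndrome label)
    rw [hsurj, finrank_top] at h1
    simp only [Module.finrank_fintype_fun_eq_card, Fintype.card_fin] at h1
    rw [Module.card_eq_pow_finrank (K := ZMod 2), ZMod.card]
    rw [← h1, pow_add, mul_comm] at hm
    exact Nat.le_of_mul_le_mul_right hm (by positivity)
  obtain ⟨g⟩ : Nonempty (LinearMap.ker (syndrome label) ↪ Fin m) :=
    Function.Embedding.nonempty_of_card_le (by simpa using hcard)
  -- Indices outside the image of `g` receive an arbitrary codeword, which does no harm to a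
  -- covering.
  have hg : ∀ w : LinearMap.ker (syndrome label), Function.invFun g (g w) = w :=
    Function.leftInverse_invFun g.injective
  have hcov : ∀ v : ι → ZMod 2, ∃ i,
      hammingDist v (Function.invFun g i : LinearMap.ker (syndrome label)) ≤ 1 := by
    intro v
    by_cases hv : syndrome label v = 0
    · refine ⟨g ⟨v, hv⟩, ?_⟩
      rw [hg]
      simp
    · set j := e ⟨syndrome label v, hv⟩ with hj
      have hk : syndrome label (v + Pi.single j 1) = 0 := by
        rw [map_add, hsingle, hj, hlabel]
        funext l
        exact CharTwo.add_self_eq_zero _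
      refine ⟨g ⟨_, hk⟩, ?_⟩
      rw [hg]
      exact (hammingDist_add_single v j).le
  exact ⟨fun i => (Function.invFun g i : LinearMap.ker (syndrome label)).1, hcov⟩

/-! ### Weighted Hamming balls as activation regions -/

theorem bit_eq_zero_or_one (a : Fin 2) : bit a = 0 ∨ bit a = 1 := by
  fin_cases a <;> simp [bit]

theorem bit_add_one (a : Fin 2) : bit (a + 1) = 1 - bit a := by
  fin_cases a <;> simp [bit]

theorem one_sub_two_mul_bit_ne_zero (a : Fin 2) : 1 - 2 * bit a ≠ 0 := by
  rcases bit_eq_zero_or_one a with h | h <;> rw [h] <;> norm_num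

theorem bit_add_mul_bit (a b : Fin 2) :
    bit a + (1 - 2 * bit a) * bit b = if b ≠ a then 1 else 0 := by
  fin_cases a <;> fin_cases b <;> norm_num [bit]

section Mismatch

variable {ι : Type*} [Fintype ι]

theorem sum_mul_bit_flip [DecidableEq ι] (a : ι → ℝ) (v : ι → Fin 2) (j : ι) :
    ∑ i, a i * bit (flip v j i) = ∑ i, a i * bit (v i) + a j * (1 - 2 * bit (v j)) := by
  rw [← sub_eq_iff_eq_add', ← Finset.sum_sub_distrib, Finset.sum_eq_single j]
  · rw [flip_same, bit_add_one]
    ring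
  · intro i _ hi
    rw [flip_of_ne _ hi, sub_self]
  · simp

/-- An affine function vanishing on a Hamming ball of radius one is zero. -/
theorem eq_zero_of_forall_ball [DecidableEq ι] {a : ι → ℝ} {b : ℝ} {c : ι → Fin 2}
    (h : ∀ v, hammingDist v c ≤ 1 → ∑ j, a j * bit (v j) + b = 0) : a = 0 ∧ b = 0 := by
  have hc := h c (by simp)
  have ha : a = 0 := by
    funext j
    have hj := h (flip c j) (by rw [hammingDist_comm, hammingDist_flip])
    rw [sum_mul_bit_flip] at hj
    have : a j * (1 - 2 * bit (c j)) = 0 := by linarith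
    exact (mul_eq_zero.1 this).resolve_right (one_sub_two_mul_bit_ne_zero _)
  refine ⟨ha, ?_⟩
  simpa [ha] using hc

/-- The sum of the weights of the coordinates in which two binary vectors differ. -/
def mismatch (w : ι → ℕ) (v c : ι → Fin 2) : ℕ := ∑ j, if v j ≠ c j then w j else 0

theorem mismatch_self (w : ι → ℕ) (c : ι → Fin 2) : mismatch w c c = 0 := by simp [mismatch]

theorem mismatch_one (v c : ι → Fin 2) : mismatch 1 v c = hammingDist v c := by
  rw [mismatch, hammingDist, Finset.card_filter]
  rfl

theorem hammingDist_le_mismatch {w : ι → ℕ} (hw : 1 ≤ w) (v c : ι → Fin 2) :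
    hammingDist v c ≤ mismatch w v c := by
  rw [← mismatch_one]
  refine Finset.sum_le_sum fun j _ => ?_
  split_ifs
  · exact hw j
  · exact le_rfl

theorem mismatch_flip [DecidableEq ι] (w : ι → ℕ) (c : ι → Fin 2) (p : ι) :
    mismatch w (flip c p) c = w p := by
  have hne : ∀ a : Fin 2, a + 1 ≠ a := by decide
  rw [mismatch, Finset.sum_eq_single p]
  · simp [flip_same, hne]
  · intro i _ hi
    simp [flip_of_ne _ hi]
  · simp

theorem mismatch_flip_flip [DecidableEq ι] (w : ι → ℕ) (c : ι → Fin 2) {p q : ι} (h : p ≠ q) :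
    mismatch w (flip (flip c p) q) c = w p + w q := by
  have hne : ∀ a : Fin 2, a + 1 ≠ a := by decide
  rw [mismatch, Finset.sum_eq_add p q h]
  · simp [flip_same, flip_of_ne _ h, flip_of_ne _ h.symm, hne]
  · rintro i - ⟨hp, hq⟩
    simp [flip_of_ne _ hp, flip_of_ne _ hq]
  · simp
  · simp

theorem cast_mismatch (w : ι → ℕ) (v c : ι → Fin 2) : (mismatch w v c : ℝ) =
    ∑ j, w j * bit (c j) + ∑ j, w j * (1 - 2 * bit (c j)) * bit (v j) := by
  rw [mismatch, Nat.cast_sum, ← Finset.sum_add_distrib]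
  refine Finset.sum_congr rfl fun j _ => ?_
  rw [mul_assoc, ← mul_add, bit_add_mul_bit]
  split_ifs <;> simp

end Mismatch

/-- The parameters with given weights and biases of the hidden units, and no output biases. -/
def hiddenParam (a : Fin m → Fin k ⊕ Fin n → ℝ) (b : Fin m → ℝ) : Param k n m :=
  (fun i j => a i (Sum.inr j), fun i j => a i (Sum.inl j), 0, b)

theorem hiddenInput_hiddenParam (a : Fin m → Fin k ⊕ Fin n → ℝ) (b : Fin m → ℝ) (i : Fin m)
    (x : State k) (y : State n) : hiddenInput i x y (hiddenParam a b) =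
      ∑ j, a i j * bit (Sum.elim x y j) + b i := by
  simp [hiddenInput_apply, hiddenParam, Fintype.sum_sum_type]

/-- The weights of the hidden unit `i`, as a function on the visible units. -/
def unitWeights (η : Param k n m) (i : Fin m) : Fin k ⊕ Fin n → ℝ := Sum.elim (η.2.1 i) (η.1 i)

theorem hiddenInput_eq_sum (η : Param k n m) (i : Fin m) (x : State k) (y : State n) :
    hiddenInput i x y η = ∑ j, unitWeights η i j * bit (Sum.elim x y j) + η.2.2.2 i := by
  simp [hiddenInput_apply, unitWeights, Fintype.sum_sum_type]

theorem outputBias_eq_sum (η : Param k n m) (x : State k) (y : State n) :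
    outputBias y η = ∑ j, (Sum.elim 0 η.2.2.1 : Fin k ⊕ Fin n → ℝ) j * bit (Sum.elim x y j) := by
  simp [outputBias_apply, Fintype.sum_sum_type]

theorem eq_zero_of_unitWeights {η : Param k n m} (hb : η.2.2.1 = 0)
    (h : ∀ i, unitWeights η i = 0 ∧ η.2.2.2 i = 0) : η = 0 := by
  refine Prod.ext ?_ (Prod.ext ?_ (Prod.ext hb ?_))
  · funext i j
    exact congrFun (h i).1 (Sum.inr j)
  · funext i j
    exact congrFun (h i).1 (Sum.inl j)
  · funext i
    exact (h i).2

/-- The parameters for which each hidden unit is activated by a weighted Hamming ball. -/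
noncomputable def ballParam (w : Fin k ⊕ Fin n → ℕ) (r : ℕ) (c : Fin m → Fin k ⊕ Fin n → Fin 2) :
    Param k n m :=
  hiddenParam (fun i j => -(w j * (1 - 2 * bit (c i j)))) fun i =>
    -- The half keeps the input away from zero, since mismatches are integers.
    r + 1 / 2 - ∑ j, w j * bit (c i j)

theorem hiddenInput_ballParam (w : Fin k ⊕ Fin n → ℕ) (r : ℕ)
    (c : Fin m → Fin k ⊕ Fin n → Fin 2) (i : Fin m) (x : State k) (y : State n) :
    hiddenInput i x y (ballParam w r c) = r + 1 / 2 - mismatch w (Sum.elim x y) (c i) := by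
  rw [ballParam, hiddenInput_hiddenParam, cast_mismatch]
  simp only [neg_mul, Finset.sum_neg_distrib]
  ring

theorem hiddenInput_ballParam_ne_zero (w : Fin k ⊕ Fin n → ℕ) (r : ℕ)
    (c : Fin m → Fin k ⊕ Fin n → Fin 2) (i : Fin m) (x : State k) (y : State n) :
    hiddenInput i x y (ballParam w r c) ≠ 0 := by
  rw [hiddenInput_ballParam]
  intro h
  have h2 : ((2 * r + 1 : ℕ) : ℝ) = ((2 * mismatch w (Sum.elim x y) (c i) : ℕ) : ℝ) := by
    push_cast
    linarith
  have := Nat.cast_injective h2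
  omega

theorem slicing_ballParam (w : Fin k ⊕ Fin n → ℕ) (r : ℕ)
    (c : Fin m → Fin k ⊕ Fin n → Fin 2) (i : Fin m) (x : State k) (y : State n) :
    slicing (ballParam w r c) i x y = if mismatch w (Sum.elim x y) (c i) ≤ r then 1 else 0 := by
  rw [slicing, hiddenInput_ballParam]
  refine if_congr ?_ rfl rfl
  constructor
  · intro h
    have h2 : ((2 * mismatch w (Sum.elim x y) (c i) : ℕ) : ℝ) < ((2 * r + 1 : ℕ) : ℝ) := by
      push_cast
      linarith
    have := Nat.cast_lt.1 h2
    omega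
  · intro h
    have : (mismatch w (Sum.elim x y) (c i) : ℝ) ≤ r := Nat.cast_le.2 h
    linarith

/-! ### Balls of radius one: packings and coverings -/

/-- A code of minimum distance four, such that some vector has distance at least three from all
codewords, yields a model with at least two output units of expected dimension. -/
theorem hasDimension_of_code (hn : 2 ≤ n) (c : Fin m → Fin k ⊕ Fin n → Fin 2)
    (hc : ∀ i i', i ≠ i' → 4 ≤ hammingDist (c i) (c i'))
    (hv : ∃ v, ∀ i, 3 ≤ hammingDist v (c i)) :
    HasDimension k n m ((n + k + 1) * m + n) ∧
      HasDimension k n m (min ((n + k + 1) * m + n) (2 ^ k * (2 ^ n - 1))) := by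
  refine hasDimension_of_injective (ballParam 1 1 c) (hiddenInput_ballParam_ne_zero 1 1 c)
    fun η f h => ?_
  set β : Fin k ⊕ Fin n → ℝ := Sum.elim 0 η.2.2.1 with hβ
  set L : Fin m → (Fin k ⊕ Fin n → Fin 2) → ℝ := fun i v =>
    ∑ j, unitWeights η i j * bit (v j) + η.2.2.2 i with hL
  have hfeat : ∀ v : Fin k ⊕ Fin n → Fin 2, ∑ j, β j * bit (v j) +
      ∑ i, (if hammingDist v (c i) ≤ 1 then 1 else 0) * L i v = f (fun j => v (Sum.inl j)) := by
    intro v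
    have he : (Sum.elim (fun j => v (Sum.inl j)) fun j => v (Sum.inr j)) = v :=
      Sum.elim_comp_inl_inr v
    rw [← h _ fun j => v (Sum.inr j), featureMap_apply, outputBias_eq_sum η fun j => v (Sum.inl j),
      he]
    simp only [slicing_ballParam, hiddenInput_eq_sum, he, mismatch_one]
    rfl
  have hout : ∀ v, (∀ i, 2 ≤ hammingDist v (c i)) →
      ∑ j, β j * bit (v j) = f (fun j => v (Sum.inl j)) := by
    intro v hv
    rw [← hfeat v, left_eq_add]
    refine Finset.sum_eq_zero fun i _ => ?_
    have := hv i
    rw [if_neg (by omega), zero_mul]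
  have hflip : ∀ (v : Fin k ⊕ Fin n → Fin 2) (j : Fin n),
      (fun i => flip v (Sum.inr j) (Sum.inl i)) = fun i => v (Sum.inl i) := fun v j =>
    funext fun i => flip_of_ne _ (by simp)
  -- The far vector and its output flips lie outside all balls and in one row, so the bias term
  -- cannot change under the flips.
  have hβ0 : η.2.2.1 = 0 := by
    obtain ⟨v, hv⟩ := hv
    funext j
    have h1 := hout v fun i => (hv i).trans' (by norm_num)
    have h2 := hout (flip v (Sum.inr j)) fun i => by
      have h3 := hammingDist_triangle v (flip v (Sum.inr j)) (c i)
      rw [hammingDist_flip] at h3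
      have := hv i
      omega
    rw [hflip, sum_mul_bit_flip, ← h1] at h2
    have h4 : β (Sum.inr j) * (1 - 2 * bit (v (Sum.inr j))) = 0 := by linarith
    exact (mul_eq_zero.1 h4).resolve_right (one_sub_two_mul_bit_ne_zero _)
  have hβ0' : β = 0 := by
    rw [hβ, hβ0]
    funext j
    cases j <;> rfl
  have hf0 : ∀ x, f x = 0 := by
    intro x
    suffices ∃ v : Fin k ⊕ Fin n → Fin 2, (fun j => v (Sum.inl j)) = x ∧
        ∀ i, 2 ≤ hammingDist v (c i) by
      obtain ⟨v, rfl, hv⟩ := this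
      rw [← hout v hv, hβ0']
      simp
    set v : Fin k ⊕ Fin n → Fin 2 := Sum.elim x 0
    by_cases hcov : ∀ i, 2 ≤ hammingDist v (c i)
    · exact ⟨v, rfl, hcov⟩
    push Not at hcov
    obtain ⟨i, hi⟩ := hcov
    -- A point at distance exactly two from one codeword is at distance at least two from the
    -- others. Flipping outputs reaches such a point within the row; two outputs suffice from
    -- distance zero or one.
    suffices ∃ u : Fin k ⊕ Fin n → Fin 2, (fun j => u (Sum.inl j)) = x ∧
        hammingDist u (c i) = 2 by
      obtain ⟨u, hu, h2⟩ := this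
      refine ⟨u, hu, fun i' => ?_⟩
      rcases eq_or_ne i i' with rfl | hii
      · exact h2.ge
      · have h3 := hammingDist_triangle_left (c i) (c i') u
        have := hc i i' hii
        omega
    let j0 : Fin n := ⟨0, by omega⟩
    let j1 : Fin n := ⟨1, by omega⟩
    have hj : j0 ≠ j1 := by simp [j0, j1]
    rcases Nat.lt_succ_iff_lt_or_eq.1 hi with hi | hi
    · have hvc : v = c i := hammingDist_eq_zero.1 (by omega)
      refine ⟨flip (flip v (Sum.inr j0)) (Sum.inr j1), by rw [hflip, hflip]; rfl, ?_⟩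
      rw [← hvc, hammingDist_comm, hammingDist_flip_flip]
      simpa using hj
    · obtain ⟨l, hl⟩ := exists_eq_flip_of_hammingDist_eq_one hi
      obtain ⟨j, hjl⟩ : ∃ j : Fin n, Sum.inr j ≠ l := by
        by_contra! hall
        exact hj (Sum.inr_injective ((hall j0).trans (hall j1).symm))
      refine ⟨flip v (Sum.inr j), hflip _ _, ?_⟩
      have h2 := hammingDist_flip_flip (flip v (Sum.inr j)) hjl
      rwa [flip_flip, ← hl] at h2
  refine eq_zero_of_unitWeights hβ0 fun i => eq_zero_of_forall_ball (c := c i) fun v hvi => ?_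
  have h1 := hfeat v
  rw [hf0, hβ0', Finset.sum_eq_single i] at h1
  · rw [if_pos hvi, one_mul] at h1
    simpa only [Pi.zero_apply, zero_mul, Finset.sum_const_zero, zero_add] using h1
  · intro i' _ hi'
    have h3 := hammingDist_triangle_left (c i) (c i') v
    have := hc i i' hi'.symm
    rw [if_neg (by omega), zero_mul]
  · simp

/-- The tangent space of a covering by Hamming balls of radius one contains all tables supported
on the covered entries. -/
theorem hasDimension_of_covering (c : Fin m → Fin k ⊕ Fin n → Fin 2)
    (hc : ∀ l : Table k n, (∀ x, ∑ y, l x y = 0) →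
      (∀ j, ∑ x, ∑ y, l x y * bit (y j) = 0) →
      (∀ i x y, hammingDist (Sum.elim x y) (c i) ≤ 1 → l x y = 0) → l = 0) :
    HasDimension k n m (2 ^ k * (2 ^ n - 1)) ∧
      HasDimension k n m (min ((n + k + 1) * m + n) (2 ^ k * (2 ^ n - 1))) := by
  refine hasDimension_of_annihilator (ballParam 1 1 c) (hiddenInput_ballParam_ne_zero 1 1 c)
    fun l hrow hl => hc l hrow (fun j => ?_) fun i x y hxy => ?_
  · have := hl (0, 0, Pi.single j 1, 0)
    simpa [featureMap_apply, outputBias_apply, hiddenInput_apply, Pi.single_apply] using this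
  -- The indicator of a point is affine on the ball: one minus the distance for the centre, the
  -- mismatch in coordinate `j` for the neighbour `flip (c i) j`.
  · obtain ⟨a, b, hab⟩ : ∃ (a : Fin k ⊕ Fin n → ℝ) (b : ℝ), ∀ v, hammingDist v (c i) ≤ 1 →
        ∑ j, a j * bit (v j) + b = if v = Sum.elim x y then 1 else 0 := by
      set u : Fin k ⊕ Fin n → Fin 2 := Sum.elim x y
      rcases Nat.le_one_iff_eq_zero_or_eq_one.1 hxy with h0 | h1
      · have hu : u = c i := hammingDist_eq_zero.1 h0
        refine ⟨fun j => -(1 - 2 * bit (c i j)), 1 - ∑ j, bit (c i j), fun v hv => ?_⟩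
        have hm := cast_mismatch 1 v (c i)
        rw [mismatch_one] at hm
        simp only [Pi.one_apply, Nat.cast_one, one_mul] at hm
        simp only [neg_mul, Finset.sum_neg_distrib, hu]
        rcases Nat.le_one_iff_eq_zero_or_eq_one.1 hv with h | h
        · rw [if_pos (hammingDist_eq_zero.1 h)]
          rw [h] at hm
          push_cast at hm
          linarith
        · rw [if_neg (by rintro rfl; simp at h)]
          rw [h] at hm
          push_cast at hm
          linarith
      · rw [hammingDist_comm] at h1
        obtain ⟨j, hj⟩ := exists_eq_flip_of_hammingDist_eq_one h1
        refine ⟨Pi.single j (1 - 2 * bit (c i j)), bit (c i j), fun v hv => ?_⟩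
        rw [Finset.sum_eq_single j (fun j' _ hj' => by simp [hj']) (by simp), Pi.single_eq_same,
          add_comm, bit_add_mul_bit]
        refine if_congr ?_ rfl rfl
        rw [hj]
        constructor
        · intro hne
          have hv1 : hammingDist (c i) v = 1 := by
            rw [hammingDist_comm]
            have : hammingDist v (c i) ≠ 0 := fun h0 => hne (by rw [hammingDist_eq_zero.1 h0])
            omega
          obtain ⟨j', rfl⟩ := exists_eq_flip_of_hammingDist_eq_one hv1
          rcases eq_or_ne j j' with rfl | hjj
          · rfl
          · exact absurd (flip_of_ne _ hjj) hne
        · rintro rfl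
          have hne : ∀ a : Fin 2, a + 1 ≠ a := by decide
          rw [flip_same]
          exact hne _
    have h := hl (hiddenParam (Pi.single i a) (Pi.single i b))
    have hval : ∀ x' y', featureMap (slicing (ballParam 1 1 c))
        (hiddenParam (Pi.single i a) (Pi.single i b)) x' y' =
        if x' = x ∧ y' = y then 1 else 0 := by
      intro x' y'
      have hiff : x' = x ∧ y' = y ↔ Sum.elim x' y' = Sum.elim x y := by
        rw [Sum.elim_eq_iff]
      rw [featureMap_apply, Finset.sum_eq_single i, hiddenInput_hiddenParam, slicing_ballParam,
        mismatch_one, if_congr hiff rfl rfl]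
      · simp only [Pi.single_eq_same]
        rw [show outputBias y' (hiddenParam (Pi.single i a) (Pi.single i b) : Param k n m) = 0 by
          simp [outputBias_apply, hiddenParam]]
        by_cases hd : hammingDist (Sum.elim x' y') (c i) ≤ 1
        · rw [if_pos hd, hab _ hd]
          simp
        · rw [if_neg hd, if_neg]
          · simp
          · intro he
            rw [he] at hd
            exact hd hxy
      · intro i' _ hi'
        rw [hiddenInput_hiddenParam]
        simp [hi']
      · simp
    simp only [hval] at h
    rw [Finset.sum_eq_single x, Finset.sum_eq_single y] at h
    · simpa using h
    · intro y' _ hy'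
      simp [hy']
    · simp
    · intro x' _ hx'
      simp [hx']
    · simp

/-- The covering may miss one entry of each row. -/
theorem hasDimension_of_row_covering (c : Fin m → Fin k ⊕ Fin n → Fin 2)
    (hc : ∀ x, ∃ y₀, ∀ y, y ≠ y₀ → ∃ i, hammingDist (Sum.elim x y) (c i) ≤ 1) :
    HasDimension k n m (2 ^ k * (2 ^ n - 1)) ∧
      HasDimension k n m (min ((n + k + 1) * m + n) (2 ^ k * (2 ^ n - 1))) := by
  refine hasDimension_of_covering c fun l hrow _ hl => funext fun x => funext fun y => ?_
  obtain ⟨y₀, hy₀⟩ := hc x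
  have h : ∀ y, y ≠ y₀ → l x y = 0 := fun y hy => by
    obtain ⟨i, hi⟩ := hy₀ y hy
    exact hl i x y hi
  by_cases hy : y = y₀
  · subst hy
    change l x y = 0
    rw [← hrow x, Finset.sum_eq_single y (fun y' _ hy' => h y' hy') (by simp)]
  · exact h y hy

/-! ### Weighted balls for a single output unit -/

section SingleOutput

variable {ι : Type*} [Fintype ι] [DecidableEq ι]

/-- The weights with two light coordinates. -/
def lightWeights {ι : Type*} [DecidableEq ι] (a b : ι) : ι → ℕ := fun j =>
  if j = a ∨ j = b then 1 else 2

theorem one_le_lightWeights {ι : Type*} [DecidableEq ι] (a b : ι) : 1 ≤ lightWeights a b :=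
  fun j => by
    simp only [lightWeights, Pi.one_apply]
    split_ifs <;> norm_num

/-- A weighted ball with two light coordinates has a single element at Hamming distance two from its
center. -/
theorem hammingDist_le_one_or_eq {a b : ι} {x c : ι → Fin 2}
    (h : mismatch (lightWeights a b) x c ≤ 2) :
    hammingDist x c ≤ 1 ∨ x = flip (flip c a) b := by
  have h1 := (hammingDist_le_mismatch (one_le_lightWeights a b) x c).trans h
  rcases Nat.lt_succ_iff_lt_or_eq.1 (Nat.lt_succ_of_le h1) with h1 | h1
  · exact Or.inl (Nat.le_of_lt_succ h1)
  right
  rw [hammingDist_comm] at h1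
  obtain ⟨p, q, hpq, rfl⟩ := exists_eq_flip_flip_of_hammingDist_eq_two h1
  rw [mismatch_flip_flip _ _ hpq] at h
  simp only [lightWeights] at h
  split_ifs at h with hp hq <;> try omega
  rcases hp with rfl | rfl <;> rcases hq with rfl | rfl
  · exact absurd rfl hpq
  · rfl
  · exact flip_comm _ _ _
  · exact absurd rfl hpq

/-- A common point within Hamming distance one of either centre puts the centres at distance at most
three; otherwise it is the same double flip of both. -/
theorem eq_of_mismatch_le_two {a b : ι} {x c c' : ι → Fin 2}
    (h : mismatch (lightWeights a b) x c ≤ 2) (h' : mismatch (lightWeights a b) x c' ≤ 2)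
    (hd : hammingDist c c' ≤ 3 → c = c') : c = c' := by
  have h1 := (hammingDist_le_mismatch (one_le_lightWeights a b) x c).trans h
  have h1' := (hammingDist_le_mismatch (one_le_lightWeights a b) x c').trans h'
  have htri := hammingDist_triangle_left c c' x
  rcases hammingDist_le_one_or_eq h with h2 | h2
  · exact hd (by omega)
  rcases hammingDist_le_one_or_eq h' with h2' | h2'
  · exact hd (by omega)
  exact flip_injective a (flip_injective b (h2.symm.trans h2'))

theorem two_lt_mismatch_flip_flip {a b e : ι} (hae : a ≠ e) (hbe : b ≠ e)
    {c c' : ι → Fin 2} (hd : hammingDist c c' ≤ 3 → c = c') :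
    2 < mismatch (lightWeights a b) (flip (flip c e) a) c' := by
  by_contra! hle
  have hcc : c = c' := by
    rcases hammingDist_le_one_or_eq hle with h | h
    · refine hd ((hammingDist_triangle_left c c' (flip (flip c e) a)).trans ?_)
      rw [hammingDist_comm _ c, hammingDist_flip_flip _ hae.symm]
      omega
    · rw [flip_comm c' a b] at h
      have h2 : flip c e = flip c' b := flip_injective a h
      refine hd ((hammingDist_triangle_left c c' (flip c e)).trans ?_)
      rw [hammingDist_comm _ c, hammingDist_flip, h2, hammingDist_comm _ c', hammingDist_flip]
      norm_num
  subst hcc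
  rw [mismatch_flip_flip _ _ hae.symm] at hle
  simp [lightWeights, hae.symm, hbe.symm] at hle

/-- An affine function vanishing on a weighted ball with two light coordinates, except possibly at
its center, is zero. -/
theorem eq_zero_of_forall_punctured_ball {a b : ι} (hab : a ≠ b) {u : ι → ℝ} {t : ℝ}
    {c : ι → Fin 2} (h : ∀ x, x ≠ c → mismatch (lightWeights a b) x c ≤ 2 →
      ∑ j, u j * bit (x j) + t = 0) : u = 0 ∧ t = 0 := by
  have hne : ∀ p : Fin 2, p + 1 ≠ p := by decide
  have h1 : ∀ j, ∑ i, u i * bit (c i) + u j * (1 - 2 * bit (c j)) + t = 0 := by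
    intro j
    rw [← sum_mul_bit_flip]
    refine h _ (fun he => hne _ ((flip_same c j).symm.trans (congrFun he j))) ?_
    rw [mismatch_flip]
    simp only [lightWeights]
    split_ifs <;> norm_num
  have h2 : ∑ i, u i * bit (c i) + u a * (1 - 2 * bit (c a)) + u b * (1 - 2 * bit (c b)) + t =
      0 := by
    have h3 := h (flip (flip c a) b)
      (fun he => hne _ ((flip_same (flip c a) b).symm.trans ((congrFun he b).trans
        (flip_of_ne c hab.symm).symm))) (by rw [mismatch_flip_flip _ _ hab]; simp [lightWeights])
    rwa [sum_mul_bit_flip, sum_mul_bit_flip, flip_of_ne c hab.symm] at h3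
  -- The centre and the double flip have the same midpoint as the flips at `a` and `b`, so the
  -- missing value at the centre is recovered.
  have hc : ∑ i, u i * bit (c i) + t = 0 := by linarith [h1 a, h1 b]
  have hu : u = 0 := by
    funext j
    have : u j * (1 - 2 * bit (c j)) = 0 := by linarith [h1 j]
    exact (mul_eq_zero.1 this).resolve_right (one_sub_two_mul_bit_ne_zero _)
  refine ⟨hu, ?_⟩
  simpa [hu] using hc

end SingleOutput

/-- A code of minimum distance four in the inputs yields a model with a single output unit of
expected dimension. -/
theorem hasDimension_of_code_single_output (hk : 3 ≤ k) (c : Fin m → Fin k → Fin 2)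
    (hc : ∀ i i', i ≠ i' → 4 ≤ hammingDist (c i) (c i')) :
    HasDimension k 1 m ((1 + k + 1) * m + 1) ∧
      HasDimension k 1 m (min ((1 + k + 1) * m + 1) (2 ^ k * (2 ^ 1 - 1))) := by
  let a : Fin k := ⟨0, by omega⟩
  let b : Fin k := ⟨1, by omega⟩
  let e : Fin k := ⟨2, by omega⟩
  have hab : a ≠ b := by simp [a, b]
  have hae : a ≠ e := by simp [a, e]
  have hbe : b ≠ e := by simp [b, e]
  have hd : ∀ i i', hammingDist (c i) (c i') ≤ 3 → i = i' := by
    intro i i' h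
    by_contra hne
    have := hc i i' hne
    omega
  set D : Fin m → State k → ℕ := fun i x => mismatch (lightWeights a b) x (c i) with hD
  have hDinj : ∀ i i' x, D i x ≤ 2 → D i' x ≤ 2 → i = i' := by
    intro i i' x h h'
    have := eq_of_mismatch_le_two h h' fun h3 => congrArg c (hd i i' h3)
    exact hd i i' (by rw [this]; simp)
  have hD0 : ∀ i x, D i x = 0 ↔ x = c i := by
    intro i x
    constructor
    · intro h
      have := hammingDist_le_mismatch (one_le_lightWeights a b) x (c i)
      exact hammingDist_eq_zero.1 (by simp only [hD] at h; omega)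
    · rintro rfl
      exact mismatch_self _ _
  -- With output weight two, the ball of radius two is the full input ball at `y = 0` and only its
  -- centre at `y = 1`. The row `y = 1` thus determines `f` off the centres.
  let w : Fin k ⊕ Fin 1 → ℕ := Sum.elim (lightWeights a b) 2
  let C : Fin m → Fin k ⊕ Fin 1 → Fin 2 := fun i => Sum.elim (c i) 0
  have hmis0 : ∀ i x, mismatch w (Sum.elim x 0) (C i) = D i x := by
    intro i x
    simp only [hD, mismatch, Fintype.sum_sum_type, C, w, Sum.elim_inl, Sum.elim_inr]
    simp
    exact Finset.sum_congr rfl fun j _ => by by_cases hj : x j = c i j <;> simp [hj]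
  have hmis1 : ∀ i x, mismatch w (Sum.elim x 1) (C i) = D i x + 2 := by
    intro i x
    simp only [hD, mismatch, Fintype.sum_sum_type, C, w, Sum.elim_inl, Sum.elim_inr]
    simp
    exact Finset.sum_congr rfl fun j _ => by by_cases hj : x j = c i j <;> simp [hj]
  refine hasDimension_of_injective (ballParam w 2 C) (hiddenInput_ballParam_ne_zero w 2 C)
    fun η f h => ?_
  set g : Fin m → State k → ℝ := fun i x => ∑ j, η.2.1 i j * bit (x j) + η.2.2.2 i with hg
  have h0 : ∀ x, ∑ i, (if D i x ≤ 2 then 1 else 0) * g i x = f x := by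
    intro x
    rw [← h x 0, featureMap_apply]
    simp only [slicing_ballParam, hmis0, hiddenInput_apply, outputBias_apply]
    simp [hg, bit]
  have h1 : ∀ x, η.2.2.1 0 + ∑ i, (if D i x = 0 then 1 else 0) * (g i x + η.1 i 0) = f x := by
    intro x
    rw [← h x 1, featureMap_apply]
    simp only [slicing_ballParam, hmis1, hiddenInput_apply, outputBias_apply]
    simp [hg, bit, add_right_comm]
  have hout : ∀ x, (∀ i, D i x ≠ 0) → f x = η.2.2.1 0 := by
    intro x hx
    rw [← h1 x, add_eq_left]
    refine Finset.sum_eq_zero fun i _ => ?_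
    rw [if_neg (hx i), zero_mul]
  -- At an input outside all weighted balls, `y = 0` gives `f x = 0` and `y = 1` gives the bias.
  -- Flipping `e` and `a` at a centre costs 2 + 1 > 2.
  have hβ : η.2.2.1 0 = 0 := by
    obtain ⟨x, hx⟩ : ∃ x, ∀ i, 2 < D i x := by
      rcases isEmpty_or_nonempty (Fin m) with hm | ⟨⟨i₀⟩⟩
      · exact ⟨0, fun i => hm.elim i⟩
      · exact ⟨flip (flip (c i₀) e) a, fun i => two_lt_mismatch_flip_flip hae hbe
          fun h3 => congrArg c (hd i₀ i h3)⟩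
    rw [← hout x fun i => by have := hx i; omega, ← h0 x]
    refine Finset.sum_eq_zero fun i _ => ?_
    rw [if_neg (hx i).not_ge, zero_mul]
  have hin : ∀ i x, D i x ≤ 2 → g i x = f x := by
    intro i x hx
    rw [← h0 x, Finset.sum_eq_single i]
    · rw [if_pos hx, one_mul]
    · intro i' _ hi'
      rw [if_neg fun h' => hi' (hDinj _ _ _ h' hx), zero_mul]
    · simp
  -- At a centre the unit is active for both outputs, and the two equations differ exactly by the
  -- output weight.
  have hW : ∀ i, η.1 i 0 = 0 := by
    intro i
    have hci : D i (c i) = 0 := (hD0 i _).2 rfl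
    have h2 := h1 (c i)
    rw [Finset.sum_eq_single i, if_pos hci, hβ, hin i (c i) (by omega)] at h2
    · linarith
    · intro i' _ hi'
      rw [if_neg fun h' => hi' (hDinj _ _ (c i) (by omega) (by omega)), zero_mul]
    · simp
  have hz : ∀ i, η.2.1 i = 0 ∧ η.2.2.2 i = 0 := by
    intro i
    refine eq_zero_of_forall_punctured_ball hab (c := c i) fun x hx hle => ?_
    have h2 := hin i x hle
    rw [hout x fun i' h' => hx ?_, hβ] at h2
    · exact h2
    · have := hDinj i i' x hle (by omega)
      subst this
      exact (hD0 i x).1 h'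
  refine eq_zero_of_unitWeights (funext fun j => ?_) fun i => ⟨funext fun j => ?_, (hz i).2⟩
  · rw [Subsingleton.elim j 0]
    exact hβ
  · rcases j with j | j
    · exact congrFun (hz i).1 j
    · rw [Subsingleton.elim j 0]
      exact hW i

/-! ### Four visible and two hidden units -/

/-- The activity of the first of two hidden units slicing the four-dimensional cube. -/
noncomputable def firstSlice (a b c d : Fin 2) : ℝ :=
  if 0 < -2 * bit a + 0 * bit b + 2 * bit c + 2 * bit d + -1 then 1 else 0

/-- The activity of the second of two hidden units slicing the four-dimensional cube. -/
noncomputable def secondSlice (a b c d : Fin 2) : ℝ :=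
  if 0 < -4 * bit a + -6 * bit b + -6 * bit c + 4 * bit d + 7 then 1 else 0

/-- The sixteen points of the cube give sixteen linear equations in as many unknowns, counting the
four values of `F`; the system is nonsingular. `F` absorbs all that depends on the first two
coordinates, so one system serves every split with at least two outputs. -/
theorem eq_zero_of_two_slices {F : Fin 2 → Fin 2 → ℝ} {p q u₀ u₁ u₂ u₃ u₄ w₀ w₁ w₂ w₃ w₄ : ℝ}
    (h : ∀ a b c d : Fin 2, p * bit c + q * bit d +
      (firstSlice a b c d * (u₀ * bit a + u₁ * bit b + u₂ * bit c + u₃ * bit d + u₄) +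
        secondSlice a b c d * (w₀ * bit a + w₁ * bit b + w₂ * bit c + w₃ * bit d + w₄)) =
      F a b) :
    (F 0 0 = 0 ∧ F 0 1 = 0 ∧ F 1 0 = 0) ∧ (p = 0 ∧ q = 0) ∧
      (u₀ = 0 ∧ u₁ = 0 ∧ u₂ = 0 ∧ u₃ = 0 ∧ u₄ = 0) ∧
      (w₀ = 0 ∧ w₁ = 0 ∧ w₂ = 0 ∧ w₃ = 0 ∧ w₄ = 0) := by
  simp only [Fin.forall_fin_two, firstSlice, secondSlice] at h
  norm_num [bit] at h
  obtain ⟨⟨⟨⟨h1, h2⟩, h3, h4⟩, ⟨h5, h6⟩, h7, h8⟩, ⟨⟨h9, h10⟩, h11, h12⟩, ⟨h13, h14⟩, h15, h16⟩ := h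
  refine ⟨⟨?_, ?_, ?_⟩, ⟨?_, ?_⟩, ⟨?_, ?_, ?_, ?_, ?_⟩, ?_, ?_, ?_, ?_, ?_⟩ <;> linarith

theorem hasDimension_two_two_two :
    HasDimension 2 2 2 ((2 + 2 + 1) * 2 + 2) ∧
      HasDimension 2 2 2 (min ((2 + 2 + 1) * 2 + 2) (2 ^ 2 * (2 ^ 2 - 1))) := by
  -- Even weights and odd biases keep both hidden inputs nonzero.
  set θ : Param 2 2 2 := hiddenParam
    ![Sum.elim ![-2, 0] ![2, 2], Sum.elim ![-4, -6] ![-6, 4]] ![-1, 7] with hθ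
  have h0 : ∀ x y, hiddenInput 0 x y θ =
      -2 * bit (x 0) + 0 * bit (x 1) + 2 * bit (y 0) + 2 * bit (y 1) + -1 := by
    intro x y
    rw [hθ, hiddenInput_hiddenParam]
    simp [Fintype.sum_sum_type, Fin.sum_univ_succ]
    try ring
  have h1 : ∀ x y, hiddenInput 1 x y θ =
      -4 * bit (x 0) + -6 * bit (x 1) + -6 * bit (y 0) + 4 * bit (y 1) + 7 := by
    intro x y
    rw [hθ, hiddenInput_hiddenParam]
    simp [Fintype.sum_sum_type, Fin.sum_univ_succ]
    try ring
  have hs0 : ∀ x y, slicing θ 0 x y = firstSlice (x 0) (x 1) (y 0) (y 1) := by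
    intro x y
    rw [slicing, h0]
    rfl
  have hs1 : ∀ x y, slicing θ 1 x y = secondSlice (x 0) (x 1) (y 0) (y 1) := by
    intro x y
    rw [slicing, h1]
    rfl
  refine hasDimension_of_injective θ (fun i x y => ?_) fun η f h => ?_
  · fin_cases i
    · change hiddenInput 0 x y θ ≠ 0
      rw [h0]
      rcases bit_eq_zero_or_one (x 0) with ha | ha <;>
      rcases bit_eq_zero_or_one (y 0) with hc | hc <;>
      rcases bit_eq_zero_or_one (y 1) with hd | hd <;>
      rw [ha, hc, hd] <;> norm_num
    · change hiddenInput 1 x y θ ≠ 0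
      rw [h1]
      rcases bit_eq_zero_or_one (x 0) with ha | ha <;>
      rcases bit_eq_zero_or_one (x 1) with hb | hb <;>
      rcases bit_eq_zero_or_one (y 0) with hc | hc <;>
      rcases bit_eq_zero_or_one (y 1) with hd | hd <;>
      rw [ha, hb, hc, hd] <;> norm_num
  · obtain ⟨⟨hF0, hF1, hF2⟩, ⟨hp, hq⟩, ⟨hu0, hu1, hu2, hu3, hu4⟩, hw0, hw1, hw2, hw3, hw4⟩ :=
      eq_zero_of_two_slices (F := fun a b => f ![a, b])
        (p := η.2.2.1 0) (q := η.2.2.1 1)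
        (u₀ := η.2.1 0 0) (u₁ := η.2.1 0 1) (u₂ := η.1 0 0) (u₃ := η.1 0 1)
        (u₄ := η.2.2.2 0) (w₀ := η.2.1 1 0) (w₁ := η.2.1 1 1) (w₂ := η.1 1 0)
        (w₃ := η.1 1 1) (w₄ := η.2.2.2 1) (by
        intro a b c d
        have h2 := h ![a, b] ![c, d]
        rw [featureMap_apply, Fin.sum_univ_two, hs0, hs1] at h2
        simp [hiddenInput_apply, outputBias_apply, Fin.sum_univ_succ, -mul_eq_mul_left_iff] at h2 ⊢
        linarith)
    have hβ : η.2.2.1 = 0 := by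
      funext j
      fin_cases j <;> simp <;> linarith
    refine eq_zero_of_unitWeights hβ fun i => ⟨funext fun j => ?_, ?_⟩
    · rcases j with j | j <;> fin_cases i <;> fin_cases j <;> simp [unitWeights] <;> assumption
    · fin_cases i <;> assumption

theorem hasDimension_one_three_two :
    HasDimension 1 3 2 ((3 + 1 + 1) * 2 + 3) ∧
      HasDimension 1 3 2 (min ((3 + 1 + 1) * 2 + 3) (2 ^ 1 * (2 ^ 3 - 1))) := by
  set θ : Param 1 3 2 := hiddenParam
    ![Sum.elim ![-2] ![0, 2, 2], Sum.elim ![-4] ![-6, -6, 4]] ![-1, 7] with hθ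
  have h0 : ∀ x y, hiddenInput 0 x y θ =
      -2 * bit (x 0) + 0 * bit (y 0) + 2 * bit (y 1) + 2 * bit (y 2) + -1 := by
    intro x y
    rw [hθ, hiddenInput_hiddenParam]
    simp [Fintype.sum_sum_type, Fin.sum_univ_succ]
    try ring
  have h1 : ∀ x y, hiddenInput 1 x y θ =
      -4 * bit (x 0) + -6 * bit (y 0) + -6 * bit (y 1) + 4 * bit (y 2) + 7 := by
    intro x y
    rw [hθ, hiddenInput_hiddenParam]
    simp [Fintype.sum_sum_type, Fin.sum_univ_succ]
    try ring
  have hs0 : ∀ x y, slicing θ 0 x y = firstSlice (x 0) (y 0) (y 1) (y 2) := by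
    intro x y
    rw [slicing, h0]
    rfl
  have hs1 : ∀ x y, slicing θ 1 x y = secondSlice (x 0) (y 0) (y 1) (y 2) := by
    intro x y
    rw [slicing, h1]
    rfl
  refine hasDimension_of_injective θ (fun i x y => ?_) fun η f h => ?_
  · fin_cases i
    · change hiddenInput 0 x y θ ≠ 0
      rw [h0]
      rcases bit_eq_zero_or_one (x 0) with ha | ha <;>
      rcases bit_eq_zero_or_one (y 1) with hc | hc <;>
      rcases bit_eq_zero_or_one (y 2) with hd | hd <;>
      rw [ha, hc, hd] <;> norm_num
    · change hiddenInput 1 x y θ ≠ 0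
      rw [h1]
      rcases bit_eq_zero_or_one (x 0) with ha | ha <;>
      rcases bit_eq_zero_or_one (y 0) with hb | hb <;>
      rcases bit_eq_zero_or_one (y 1) with hc | hc <;>
      rcases bit_eq_zero_or_one (y 2) with hd | hd <;>
      rw [ha, hb, hc, hd] <;> norm_num
  · obtain ⟨⟨hF0, hF1, hF2⟩, ⟨hp, hq⟩, ⟨hu0, hu1, hu2, hu3, hu4⟩, hw0, hw1, hw2, hw3, hw4⟩ :=
      eq_zero_of_two_slices (F := fun a b => f ![a] - η.2.2.1 0 * bit b)
        (p := η.2.2.1 1) (q := η.2.2.1 2)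
        (u₀ := η.2.1 0 0) (u₁ := η.1 0 0) (u₂ := η.1 0 1) (u₃ := η.1 0 2)
        (u₄ := η.2.2.2 0) (w₀ := η.2.1 1 0) (w₁ := η.1 1 0) (w₂ := η.1 1 1)
        (w₃ := η.1 1 2) (w₄ := η.2.2.2 1) (by
        intro a b c d
        have h2 := h ![a] ![b, c, d]
        rw [featureMap_apply, Fin.sum_univ_two, hs0, hs1] at h2
        simp [hiddenInput_apply, outputBias_apply, Fin.sum_univ_succ, -mul_eq_mul_left_iff] at h2 ⊢
        linarith)
    simp [bit] at hF0 hF1 hF2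
    have hβ : η.2.2.1 = 0 := by
      funext j
      fin_cases j <;> simp <;> linarith
    refine eq_zero_of_unitWeights hβ fun i => ⟨funext fun j => ?_, ?_⟩
    · rcases j with j | j <;> fin_cases i <;> fin_cases j <;> simp [unitWeights] <;> assumption
    · fin_cases i <;> assumption

theorem hasDimension_zero_four_two :
    HasDimension 0 4 2 ((4 + 0 + 1) * 2 + 4) ∧
      HasDimension 0 4 2 (min ((4 + 0 + 1) * 2 + 4) (2 ^ 0 * (2 ^ 4 - 1))) := by
  set θ : Param 0 4 2 := hiddenParam
    ![Sum.elim ![] ![-2, 0, 2, 2], Sum.elim ![] ![-4, -6, -6, 4]] ![-1, 7] with hθ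
  have h0 : ∀ x y, hiddenInput 0 x y θ =
      -2 * bit (y 0) + 0 * bit (y 1) + 2 * bit (y 2) + 2 * bit (y 3) + -1 := by
    intro x y
    rw [hθ, hiddenInput_hiddenParam]
    simp [Fintype.sum_sum_type, Fin.sum_univ_succ]
    try ring
  have h1 : ∀ x y, hiddenInput 1 x y θ =
      -4 * bit (y 0) + -6 * bit (y 1) + -6 * bit (y 2) + 4 * bit (y 3) + 7 := by
    intro x y
    rw [hθ, hiddenInput_hiddenParam]
    simp [Fintype.sum_sum_type, Fin.sum_univ_succ]
    try ring
  have hs0 : ∀ x y, slicing θ 0 x y = firstSlice (y 0) (y 1) (y 2) (y 3) := by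
    intro x y
    rw [slicing, h0]
    rfl
  have hs1 : ∀ x y, slicing θ 1 x y = secondSlice (y 0) (y 1) (y 2) (y 3) := by
    intro x y
    rw [slicing, h1]
    rfl
  refine hasDimension_of_injective θ (fun i x y => ?_) fun η f h => ?_
  · fin_cases i
    · change hiddenInput 0 x y θ ≠ 0
      rw [h0]
      rcases bit_eq_zero_or_one (y 0) with ha | ha <;>
      rcases bit_eq_zero_or_one (y 2) with hc | hc <;>
      rcases bit_eq_zero_or_one (y 3) with hd | hd <;>
      rw [ha, hc, hd] <;> norm_num
    · change hiddenInput 1 x y θ ≠ 0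
      rw [h1]
      rcases bit_eq_zero_or_one (y 0) with ha | ha <;>
      rcases bit_eq_zero_or_one (y 1) with hb | hb <;>
      rcases bit_eq_zero_or_one (y 2) with hc | hc <;>
      rcases bit_eq_zero_or_one (y 3) with hd | hd <;>
      rw [ha, hb, hc, hd] <;> norm_num
  · obtain ⟨⟨hF0, hF1, hF2⟩, ⟨hp, hq⟩, ⟨hu0, hu1, hu2, hu3, hu4⟩, hw0, hw1, hw2, hw3, hw4⟩ :=
      eq_zero_of_two_slices (F := fun a b => f ![] - η.2.2.1 0 * bit a - η.2.2.1 1 * bit b)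
        (p := η.2.2.1 2) (q := η.2.2.1 3)
        (u₀ := η.1 0 0) (u₁ := η.1 0 1) (u₂ := η.1 0 2) (u₃ := η.1 0 3)
        (u₄ := η.2.2.2 0) (w₀ := η.1 1 0) (w₁ := η.1 1 1) (w₂ := η.1 1 2)
        (w₃ := η.1 1 3) (w₄ := η.2.2.2 1) (by
        intro a b c d
        have h2 := h ![] ![a, b, c, d]
        rw [featureMap_apply, Fin.sum_univ_two, hs0, hs1] at h2
        simp [hiddenInput_apply, outputBias_apply, Fin.sum_univ_succ, -mul_eq_mul_left_iff] at h2 ⊢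
        linarith)
    simp [bit] at hF0 hF1 hF2
    have hβ : η.2.2.1 = 0 := by
      funext j
      fin_cases j <;> simp <;> linarith
    refine eq_zero_of_unitWeights hβ fun i => ⟨funext fun j => ?_, ?_⟩
    · rcases j with j | j <;> fin_cases i <;> fin_cases j <;> simp [unitWeights] <;> assumption
    · fin_cases i <;> assumption

/-! ### Exceptional and degenerate cases -/

/-- The ball around zero misses both entries of the row `x = 1`, so the row sum alone is not enough
there; the output bias supplies the second equation. -/
theorem hasDimension_two_one_one : HasDimension 2 1 1 (2 ^ 2 * (2 ^ 1 - 1)) ∧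
    HasDimension 2 1 1 (min ((1 + 2 + 1) * 1 + 1) (2 ^ 2 * (2 ^ 1 - 1))) := by
  refine hasDimension_of_covering (fun _ => 0) fun l hrow hbias hl => ?_
  have hy : ∀ y : State 1, y = 0 ∨ y = 1 := by decide
  have hx : ∀ x : State 2, x ≠ 1 → hammingDist (Sum.elim x (0 : State 1)) 0 ≤ 1 := by decide
  have hsum : ∀ g : State 1 → ℝ, ∑ y, g y = g 0 + g 1 := fun g => by
    rw [← (Equiv.funUnique (Fin 1) (Fin 2)).symm.sum_comp]
    exact Fin.sum_univ_two _
  have h1 : ∀ x, x ≠ 1 → l x = 0 := by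
    intro x hne
    have h0 := hl 0 x 0 (hx x hne)
    have hr := hrow x
    rw [hsum, h0, zero_add] at hr
    funext y
    rcases hy y with rfl | rfl
    · exact h0
    · exact hr
  have hb := hbias 0
  rw [Finset.sum_eq_single 1 (fun x _ hne => by simp [h1 x hne]) (by simp), hsum] at hb
  have hr := hrow 1
  rw [hsum] at hr
  simp [bit] at hb
  funext x
  by_cases hne : x = 1
  · subst hne
    funext y
    rcases hy y with rfl | rfl
    · simpa [hb] using hr
    · exact hb
  · exact h1 x hne

/-- The models that do not have the dimension of their parameter space have full dimension. -/
theorem hasDimension_of_mem_exceptions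
    (h : (k, n, m) ∈ ({(0, 1, 1), (1, 1, 1), (0, 2, 1), (2, 1, 1), (3, 1, 2)} : Set (ℕ × ℕ × ℕ))) :
    HasDimension k n m (min ((n + k + 1) * m + n) (2 ^ k * (2 ^ n - 1))) := by
  simp only [Set.mem_insert_iff, Set.mem_singleton_iff, Prod.mk.injEq] at h
  rcases h with ⟨rfl, rfl, rfl⟩ | ⟨rfl, rfl, rfl⟩ | ⟨rfl, rfl, rfl⟩ | ⟨rfl, rfl, rfl⟩ |
    ⟨rfl, rfl, rfl⟩
  · exact (hasDimension_of_row_covering (fun _ => 0) (by decide)).2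
  · exact (hasDimension_of_row_covering (fun _ => 0) (by decide)).2
  · exact (hasDimension_of_row_covering (fun _ => 0) (by decide)).2
  · exact hasDimension_two_one_one.2
  -- Every input of length three is within one flip of `000` or `111`, so the column `y = 0` is
  -- covered.
  · refine (hasDimension_of_row_covering ![0, Sum.elim 1 0] fun x => ⟨1, ?_⟩).2
    revert x
    decide

theorem hasDimension_of_output_eq_zero (k m : ℕ) : HasDimension k 0 m 0 := by
  have := hasDimension_of_le_jacobianRank (0 : Param k 0 m) (by simp)
  simpa using this

theorem hasDimension_of_hidden_eq_zero (k n : ℕ) :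
    HasDimension k n 0 ((n + k + 1) * 0 + n) ∧
      HasDimension k n 0 (min ((n + k + 1) * 0 + n) (2 ^ k * (2 ^ n - 1))) := by
  refine hasDimension_of_injective 0 (fun i => i.elim0) fun η f h => ?_
  have h0 := h 0 0
  refine eq_zero_of_unitWeights (funext fun j => ?_) fun i => i.elim0
  have h1 := h 0 (Pi.single j 1)
  rw [← h0] at h1
  simp only [featureMap_apply, outputBias_apply, Finset.univ_eq_empty, Finset.sum_empty] at h1
  rw [Finset.sum_eq_single j (fun i _ hi => by simp [bit, hi]) (by simp)] at h1
  simpa [bit] using h1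

/-! ### From the numerical bounds to codes -/

/-- The strict form pays for the counting in `exists_far_vector`; the weak form `two_mul_le` pays
for the labels in `exists_even_code`. -/
theorem two_mul_lt {N : ℕ} (hN : 5 ≤ N) : 2 * N < 2 ^ Nat.log 2 (N ^ 2 - N + 2) := by
  have h := Nat.lt_pow_succ_log_self one_lt_two (N ^ 2 - N + 2)
  have h2 : 4 * N ≤ N ^ 2 - N := Nat.le_sub_of_add_le (by nlinarith)
  rw [pow_succ 2] at h
  omega

theorem two_mul_le {N : ℕ} (hN : 2 ≤ N) : 2 * N ≤ 2 ^ Nat.log 2 (N ^ 2 - N + 2) := by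
  rcases Nat.lt_or_ge N 5 with h | h
  · interval_cases N <;> decide
  · exact (two_mul_lt h).le

theorem hasDimension_of_two_le_output (hn : 2 ≤ n)
    (hm : m * 2 ^ Nat.log 2 ((k + n) ^ 2 - (k + n) + 2) ≤ 2 ^ (k + n))
    (hex : (k, n, m) ≠ (0, 2, 1)) :
    HasDimension k n m ((n + k + 1) * m + n) ∧
      HasDimension k n m (min ((n + k + 1) * m + n) (2 ^ k * (2 ^ n - 1))) := by
  -- Here the count for a far vector would need 2 · 4 · 2 < 16.
  by_cases h4 : k + n = 4 ∧ m = 2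
  · obtain ⟨hkn, rfl⟩ := h4
    obtain ⟨rfl, rfl⟩ | ⟨rfl, rfl⟩ | ⟨rfl, rfl⟩ :
        (k = 2 ∧ n = 2) ∨ (k = 1 ∧ n = 3) ∨ (k = 0 ∧ n = 4) := by omega
    · exact hasDimension_two_two_two
    · exact hasDimension_one_three_two
    · exact hasDimension_zero_four_two
  have hle := two_mul_le (N := k + n) (by omega)
  have hcard : Fintype.card (Fin k ⊕ Fin n) = k + n := by simp
  have hfar : 2 * ((k + n) * m) < 2 ^ (k + n) := by
    rcases Nat.eq_zero_or_pos m with rfl | hm0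
    · simp
    rcases Nat.lt_or_ge (k + n) 5 with hlt | hge
    · have hN : k + n = 2 ∨ k + n = 3 ∨ k + n = 4 := by omega
      rcases hN with hN | hN | hN
      · rw [hN, show Nat.log 2 (2 ^ 2 - 2 + 2) = 2 by decide] at hm
        exact absurd (by ext <;> simp <;> omega) hex
      · rw [hN, show Nat.log 2 (3 ^ 2 - 3 + 2) = 3 by decide] at hm
        rw [hN]
        omega
      · rw [hN, show Nat.log 2 (4 ^ 2 - 4 + 2) = 3 by decide] at hm
        rw [hN]
        omega
    · have := Nat.mul_lt_mul_of_pos_right (two_mul_lt hge) hm0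
      rw [mul_comm (2 ^ _)] at this
      rw [← mul_assoc]
      exact this.trans_le hm
  obtain ⟨s, hs⟩ : ∃ s, Nat.log 2 ((k + n) ^ 2 - (k + n) + 2) = s + 1 :=
    Nat.exists_eq_succ_of_ne_zero fun h0 => by rw [h0] at hle; omega
  rw [hs] at hm hle
  have : Nonempty (Fin k ⊕ Fin n) := ⟨Sum.inr ⟨0, by omega⟩⟩
  obtain ⟨c, hc0, hc⟩ := exists_even_code (ι := Fin k ⊕ Fin n) (m := m) (s := s)
    (by rw [hcard]; rw [pow_succ] at hle; omega) (by rwa [hcard])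
  exact hasDimension_of_code hn c hc (exists_far_vector c hc0 (by rwa [hcard]))

theorem hasDimension_of_output_eq_one
    (hm : m * 2 ^ Nat.log 2 ((k + 1) ^ 2 - (k + 1) + 2) ≤ 2 ^ (k + 1))
    (hex : (k, 1, m) ∉
      ({(0, 1, 1), (1, 1, 1), (0, 2, 1), (2, 1, 1), (3, 1, 2)} : Set (ℕ × ℕ × ℕ))) :
    HasDimension k 1 m ((1 + k + 1) * m + 1) ∧
      HasDimension k 1 m (min ((1 + k + 1) * m + 1) (2 ^ k * (2 ^ 1 - 1))) := by
  rcases Nat.eq_zero_or_pos m with rfl | hm0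
  · exact hasDimension_of_hidden_eq_zero k 1
  simp only [Set.mem_insert_iff, Set.mem_singleton_iff, Prod.mk.injEq, true_and] at hex
  rcases Nat.lt_or_ge k 4 with hlt | hge
  · have hk3 : k = 3 ∧ m = 1 := by
      interval_cases k
      · rw [show Nat.log 2 ((0 + 1) ^ 2 - (0 + 1) + 2) = 1 by decide] at hm
        omega
      · rw [show Nat.log 2 ((1 + 1) ^ 2 - (1 + 1) + 2) = 2 by decide] at hm
        omega
      · rw [show Nat.log 2 ((2 + 1) ^ 2 - (2 + 1) + 2) = 3 by decide] at hm
        omega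
      · rw [show Nat.log 2 ((3 + 1) ^ 2 - (3 + 1) + 2) = 3 by decide] at hm
        omega
    obtain ⟨rfl, rfl⟩ := hk3
    exact hasDimension_of_code_single_output le_rfl (fun _ => 0) fun i i' hne =>
      absurd (Subsingleton.elim i i') hne
  · have hle : 4 * k ≤ 2 ^ Nat.log 2 ((k + 1) ^ 2 - (k + 1) + 2) := by
      rcases Nat.lt_or_ge k 7 with h7 | h7
      · interval_cases k <;> decide
      · have h := Nat.lt_pow_succ_log_self one_lt_two ((k + 1) ^ 2 - (k + 1) + 2)
        have h2 : 8 * k ≤ (k + 1) ^ 2 - (k + 1) + 2 := by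
          have : 8 * k - 2 ≤ (k + 1) ^ 2 - (k + 1) :=
            Nat.le_sub_of_add_le (by zify [show 2 ≤ 8 * k by omega]; nlinarith)
          omega
        rw [pow_succ 2] at h
        omega
    obtain ⟨s, hs⟩ : ∃ s, Nat.log 2 ((k + 1) ^ 2 - (k + 1) + 2) = s + 2 := by
      refine Nat.exists_eq_add_of_le' ?_
      by_contra! hlt
      have := Nat.pow_le_pow_right two_pos (Nat.le_of_lt_succ hlt)
      omega
    rw [hs] at hm hle
    obtain ⟨c, -, hc⟩ := exists_even_code (ι := Fin k) (m := m) (s := s)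
      (by rw [Fintype.card_fin]; rw [pow_add] at hle; omega)
      -- The code has length `k` whereas the bound is for `k + 1` visible units; the spare factor
      -- two lowers the exponent from `s + 2` to `s + 1`.
      (by
        rw [Fintype.card_fin]
        rw [pow_succ, pow_succ 2 k, ← mul_assoc] at hm
        exact Nat.le_of_mul_le_mul_right hm two_pos)
    exact hasDimension_of_code_single_output (by omega) c hc

/-- A covering code leaves no entry uncovered, so neither the row sums nor the bias equations are
needed. -/
theorem hasDimension_of_many_hidden (hm : 2 ^ (k + n) ≤ m * 2 ^ Nat.log 2 (k + n + 1)) :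
    HasDimension k n m (2 ^ k * (2 ^ n - 1)) := by
  have hcard : Fintype.card (Fin k ⊕ Fin n) = k + n := by simp
  obtain ⟨c, hc⟩ := exists_covering_code (ι := Fin k ⊕ Fin n) (m := m)
    (by rw [hcard]; exact Nat.pow_log_le_self 2 (by omega)) (by rwa [hcard])
  refine (hasDimension_of_covering c fun l _ _ hl => funext fun x => funext fun y => ?_).1
  obtain ⟨i, hi⟩ := hc (Sum.elim x y)
  exact hl i x y hi

/-! ### Translation of the real-valued bounds and conclusion -/

theorem floor_logb_two (q : ℕ) : ⌊Real.logb 2 q⌋ = Nat.log 2 q := by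
  have h := Real.floor_logb_natCast (b := 2) (r := q) (Nat.cast_nonneg q)
  rwa [Int.log_natCast] at h

theorem two_zpow_sub (N r : ℕ) : (2 : ℝ) ^ ((N : ℤ) - (r : ℤ)) = 2 ^ N / 2 ^ r := by
  rw [zpow_sub₀ two_ne_zero, zpow_natCast, zpow_natCast]

theorem le_two_zpow_iff (N r m : ℕ) :
    (m : ℝ) ≤ 2 ^ ((N : ℤ) - (r : ℤ)) ↔ m * 2 ^ r ≤ 2 ^ N := by
  rw [two_zpow_sub, le_div_iff₀ (by positivity)]
  exact_mod_cast Iff.rfl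

theorem two_zpow_le_iff (N r m : ℕ) :
    (2 : ℝ) ^ ((N : ℤ) - (r : ℤ)) ≤ m ↔ 2 ^ N ≤ m * 2 ^ r := by
  rw [two_zpow_sub, div_le_iff₀ (by positivity)]
  exact_mod_cast Iff.rfl

end CRBM

theorem mainTheorem8 (k n m : ℕ) :
    ((m : ℝ) ≤ (2 : ℝ) ^ (((k : ℤ) + (n : ℤ))
        - ⌊Real.logb 2 (((k : ℝ) + (n : ℝ)) ^ 2 - ((k : ℝ) + (n : ℝ)) + 2)⌋) →
      (1 ≤ n →
        (k, n, m) ∉ ({(0, 1, 1), (1, 1, 1), (0, 2, 1), (2, 1, 1), (3, 1, 2)} : Set (ℕ × ℕ × ℕ)) →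
        CRBM.HasDimension k n m ((n + k + 1) * m + n)) ∧
      CRBM.HasDimension k n m (min ((n + k + 1) * m + n) (2 ^ k * (2 ^ n - 1)))) ∧
    ((2 : ℝ) ^ (((k : ℤ) + (n : ℤ)) - ⌊Real.logb 2 ((k : ℝ) + (n : ℝ) + 1)⌋) ≤ (m : ℝ) →
      CRBM.HasDimension k n m (2 ^ k * (2 ^ n - 1))) := by
  constructor
  · intro hm
    have hq : ((k : ℝ) + n) ^ 2 - (k + n) + 2 = ((k + n) ^ 2 - (k + n) + 2 : ℕ) := by
      have : k + n ≤ (k + n) ^ 2 := Nat.le_self_pow two_ne_zero _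
      push_cast [Nat.cast_sub this]
      ring
    rw [hq, CRBM.floor_logb_two, ← Nat.cast_add k n, CRBM.le_two_zpow_iff] at hm
    have hexp : 1 ≤ n → (k, n, m) ∉
        ({(0, 1, 1), (1, 1, 1), (0, 2, 1), (2, 1, 1), (3, 1, 2)} : Set (ℕ × ℕ × ℕ)) →
        CRBM.HasDimension k n m ((n + k + 1) * m + n) ∧
          CRBM.HasDimension k n m (min ((n + k + 1) * m + n) (2 ^ k * (2 ^ n - 1))) := by
      intro hn hex
      rcases hn.eq_or_lt with rfl | hn2
      · exact CRBM.hasDimension_of_output_eq_one hm hex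
      · exact CRBM.hasDimension_of_two_le_output hn2 hm fun h => hex (by simp [h])
    refine ⟨fun hn hex => (hexp hn hex).1, ?_⟩
    rcases Nat.eq_zero_or_pos n with rfl | hn
    · simpa using CRBM.hasDimension_of_output_eq_zero k m
    · by_cases hex : (k, n, m) ∈
          ({(0, 1, 1), (1, 1, 1), (0, 2, 1), (2, 1, 1), (3, 1, 2)} : Set (ℕ × ℕ × ℕ))
      · exact CRBM.hasDimension_of_mem_exceptions hex
      · exact (hexp hn hex).2
  · intro hm
    have hq : (k : ℝ) + n + 1 = (k + n + 1 : ℕ) := by push_cast; ring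
    rw [hq, CRBM.floor_logb_two, ← Nat.cast_add k n, CRBM.two_zpow_le_iff] at hm
    exact CRBM.hasDimension_of_many_hidden hm
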